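/- Notation. Let $\mathcal J$ be the set of all finite nondecreasing tuples $\mathbf j=(j_1,\dots,j_m)$ of integers with $m\ge 0$ and $1\le j_1\le\dots\le j_m$ (the empty tuple, $m=0$, corresponds to the constant term). For $J\subset\mathcal J$, $m,n\ge 1$, let $$J(m,n)=\{\mathbf j\in J:\ \mathbf j \text{ has length } m \text{ and } j_m\le n\},$$ $$J(m,n)^*=\{(j_1,\dots,j_{m-1})\in\mathcal J:\ (j_1,\dots,j_{m-1},k)\in J(m,n)\text{ for some }k\ge 1\},$$ and let $|A|$ be the number of elements of a finite set $A$. For $u\in\mathbb C^n$ and $\mathbf j\in\mathcal J$ with entries at most $n$ put $u_{\mathbf j}=u_{j_1}\cdots u_{j_m}$, and for a holomorphic function $f$ on a Reinhardt domain $R\subset\mathbb C^n$ containing $0$ let $c_{\mathbf j}(f)$ be the coefficient of the monomial $z_{\mathbf j}$ in the power series expansion of $f$ at $0$. Let $H_\infty(R)$ be the space of bounded holomorphic functions on $R$ with $\|f\|_\infty=\sup_{z\in R}|f(z)|$. The Bohr radius of $R$ with respect to $J$ is $$K(R;J)=\sup\Big\{0\le \rho\le 1:\ \sup_{u\in\rho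 R}\sum_{\mathbf j\in J}|c_{\mathbf j}(f)\,u_{\mathbf j}|\le\|f\|_\infty\ \text{ for all } f\in H_\infty(R)\Big\},$$ where only those $\mathbf j\in J$ with entries at most $n$ contribute to the sum, and $K(R)=K(R;\mathcal J)$. Let $B_{\ell_r^n}$ be the open unit ball of $\mathbb C^n$ with the $\ell_r$-norm. Theorem. Let $1\le r\le\infty$ and $\sigma=1-\frac1{\min(r,2)}$. (1) There is a constant $C=C(r)\ge\frac1{3e^2}$ such that for every $J\subset\mathcal J$ and every $n\ge 1$ the supremum $\sup_{m\ge1}|J(m,n)^*|^{\sigma/m}$ is finite and $$\frac{C}{\sup_{m\ge1}|J(m,n)^*|^{\sigma/m}}\le K(B_{\ell_r^n};J).$$ (Here $0^0=1$. The left-hand side is read as $0$ in the degenerate case that the supremum is $0$, that is, if $\sigma>0$ and $J(m,n)=\emptyset$ for all $m\ge1$.) (2) In particular (case $J=\mathcal J$), there is a constant $c=c(r)>0$ such that for every $n\ge1$ $$K(B_{\ell_r^n})\ge c\left(\frac{\log n}{n}\right)^{\sigma}.$$ (Again $0^0=1$.) -/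

import Mathlib

open scoped ENNReal Pointwise

noncomputable section

namespace BohrRadius

/-- The set of all indices `j = (j₁, …, jₘ)` of finite length `m ≥ 0` with
`1 ≤ j₁ ≤ … ≤ jₘ`. The index of length zero (which belongs to the constant term of a power
series) is included. -/
def allIndices : Set (List ℕ) :=
  {j | j.Pairwise (· ≤ ·) ∧ ∀ k ∈ j, 1 ≤ k}

/-- `J(m,n)`: the indices of `J` which have length `m` and all of whose entries are at
most `n`. -/
def homogeneousPart (J : Set (List ℕ)) (m n : ℕ) : Set (List ℕ) :=
  {j | j ∈ J ∧ j.length = m ∧ ∀ k ∈ j, k ≤ n}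

/-- The reduced set `J* = {j : (j, k) ∈ J for some k ≥ 1}` of a set `J` of indices. If all
elements of `J` have length `m`, then those of `J*` have length `m - 1`. -/
def reducedSet (J : Set (List ℕ)) : Set (List ℕ) :=
  {j | j ∈ allIndices ∧ ∃ k : ℕ, 1 ≤ k ∧ j ++ [k] ∈ J}

/-- The elements of `J` with all entries in `{1, …, n}`, with entries written as elements
`0, …, n - 1` of `Fin n`, so that they index the coordinates of `ℂⁿ`. -/
def indicesIn (J : Set (List ℕ)) (n : ℕ) : Set (List (Fin n)) :=
  {j | j.map (fun i => (i : ℕ) + 1) ∈ J}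

/-- The monomial `u_j = u_{j₁} ⋯ u_{jₘ}`. -/
def monomialValue {n : ℕ} (j : List (Fin n)) (u : Fin n → ℂ) : ℂ :=
  (j.map u).prod

/-- The monomial (Taylor) coefficient at the origin
`c_j(f) = (1 / α!) (∂^m f / ∂z_{j₁} ⋯ ∂z_{jₘ})(0)`, where `αᵢ` is the number of times that `i`
occurs in `j` and `α! = ∏ᵢ αᵢ!`. -/
def monomialCoeff {n : ℕ} (f : (Fin n → ℂ) → ℂ) (j : List (Fin n)) : ℂ :=
  iteratedFDeriv ℂ j.length f 0 (fun q => Pi.single (j.get q) 1) /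
    ((∏ i : Fin n, (j.count i).factorial : ℕ) : ℂ)

/-- `‖f‖_∞ = sup_{z ∈ R} |f z|`, as an extended nonnegative number. -/
def supNorm {n : ℕ} (R : Set (Fin n → ℂ)) (f : (Fin n → ℂ) → ℂ) : ℝ≥0∞ :=
  ⨆ z ∈ R, ‖f z‖ₑ

/-- `f ∈ H_∞(R)`: `f` is holomorphic (complex Fréchet differentiable) and bounded on the
open set `R`. -/
def IsBoundedHolomorphic {n : ℕ} (R : Set (Fin n → ℂ)) (f : (Fin n → ℂ) → ℂ) : Prop :=
  DifferentiableOn ℂ f R ∧ ∃ M : ℝ, ∀ z ∈ R, ‖f z‖ ≤ M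

/-- The Bohr radius `K(R; J)` of a Reinhardt domain `R` in `ℂⁿ` with respect to the index set
`J`: the supremum of all `0 ≤ ρ ≤ 1` such that
`sup_{u ∈ ρR} ∑_{j ∈ J} |c_j(f) u_j| ≤ ‖f‖_∞` for all `f ∈ H_∞(R)`. Only those `j ∈ J` whose
entries are at most `n` belong to a monomial on `ℂⁿ`. -/
def bohrRadius {n : ℕ} (R : Set (Fin n → ℂ)) (J : Set (List ℕ)) : ℝ :=
  sSup {ρ : ℝ | 0 ≤ ρ ∧ ρ ≤ 1 ∧ ∀ f : (Fin n → ℂ) → ℂ, IsBoundedHolomorphic R f →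
    (⨆ u ∈ ρ • R, ∑' j : indicesIn J n, ‖monomialCoeff f j * monomialValue (j : List (Fin n)) u‖ₑ)
      ≤ supNorm R f}

/-- The open unit ball of `ℓ_r^n`, that is, of `ℂⁿ` with the `r`-norm. -/
def lpBall (r : ℝ≥0∞) (n : ℕ) : Set (Fin n → ℂ) :=
  {z | ‖(WithLp.toLp r z : PiLp r fun _ : Fin n => ℂ)‖ < 1}

/-- The exponent `σ = 1 - 1 / min (r, 2)`. -/
def sigma (r : ℝ≥0∞) : ℝ :=
  1 - 1 / (min r 2).toReal

end BohrRadius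

end

/-!
# A lower bound for Bohr radii of `ℓ_r` balls

Let `f = ∑ P_m` be the homogeneous expansion of a holomorphic function with `|f| ≤ M` on the ball.
Restriction to complex lines through the origin and the one-variable estimate
`|c_m| ≤ 2 (M - |c_0|)` (`norm_taylorCoeff_le`) give `|P_m| ≤ 2 (M - |f 0|)` on the ball
(`exists_homogeneous_expansion`). Hence everything rests on an estimate for the coefficients of
one `m`-homogeneous polynomial `P` with `|P| ≤ B`: for every set `T` of multi-indices of order
`m - 1` and every `v` in the ball,
`∑_{α ∈ T} ∑_k |a_{α + e_k} v ^ (α + e_k)| ≤ 6 ^ m |T| ^ σ B` (`sum_coeff_le`).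
With `T` the set of multi-indices of `J(m, n)*` and `ρ = 1 / (3 e² S)`, where `S` is the supremum in
the theorem, the Bohr sum is at most `|f 0| + ∑_{m ≥ 1} 3⁻ᵐ · 2 (M - |f 0|) = M`, because
`6 / (3 e²) ≤ 1/3` (`bohr_inequality`).

The estimate `sum_coeff_le` is obtained from the directional derivatives
`dP(z) w = ∑_{|α| = m - 1} b_α(w) z ^ α`, where `b_α(w) = ∑_k (α_k + 1) a_{α + e_k} w_k`. The Cauchy
estimate for `t ↦ P (z + t w)` gives `|dP(z) w| ≤ 2 ^ m B` for `z` and `w` in the ball.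

* For `r ≤ 2`, the Cauchy estimate for the coefficient `b_α(w)` at the point of the unit sphere
  where `|z ^ α|` is maximal bounds `∑_k |a_{α + e_k} v_k|` by
  `2 ^ m (e ^ (m - 1) (m - 1)! / α!) ^ (1/r) B`, and Hölder's inequality over `T` together with the
  multinomial theorem for `∑ |v_i| ^ r` concludes (`sum_coeff_le_of_lpBall`).
* For `r ≥ 2`, replacing `P` by `z ↦ P (v z)` reduces the claim to the polydisc. There the
  Cauchy–Schwarz inequality over `T` produces the `L²` norms of the partial derivatives `∂_k P`
  on the torus, which are bounded by `2 ^ (m - 1)` times their `L¹` norms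
  (`sqrt_sum_norm_sq_coeff_le`), while `∑_k |∂_k P(z)| = sup_w |dP(z) w|`
  (`sum_coeff_le_of_polydisc`).

Averages over the torus are replaced by finite averages over roots of unity, which are exact for
polynomials of bounded degree.

For the full index set, `|J(m, n)*| x ^ (m - 1) ≤ (1 - x)⁻ⁿ` with `x = log n / (4 n)` yields
`|J(m, n)*| ≤ (4 n / log n) ^ m` (`ncard_reducedSet_le_pow`).
-/

namespace BohrRadius

/-! ### Polynomials on the finite torus -/

section

open Finset ComplexConjugate

/-- Orthogonality of the powers of a primitive `N`-th root of unity, for exponents below `N`. -/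
lemma sum_rootOfUnity {N : ℕ} {ω : ℂ} (hω : IsPrimitiveRoot ω N) (hn : ‖ω‖ = 1) {p q : ℕ}
    (hp : p < N) (hq : q < N) :
    ∑ k : Fin N, (ω ^ (k : ℕ)) ^ p * conj ((ω ^ (k : ℕ)) ^ q) = if p = q then (N : ℂ) else 0 := by
  have h0 : ω ≠ 0 := by rintro rfl; simp at hn
  have hc : conj ω = ω⁻¹ := (Complex.inv_eq_conj hn).symm
  have h1 : ∀ k : Fin N, (ω ^ (k : ℕ)) ^ p * conj ((ω ^ (k : ℕ)) ^ q)
      = (ω ^ p * (ω⁻¹) ^ q) ^ (k : ℕ) := by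
    intro k
    rw [map_pow, map_pow, hc]
    ring
  simp_rw [h1]
  rw [Fin.sum_univ_eq_sum_range (fun k => (ω ^ p * (ω⁻¹) ^ q) ^ k) N]
  split_ifs with h
  · subst h
    simp [h0]
  · have hne : ω ^ p * (ω⁻¹) ^ q ≠ 1 := by
      intro h2
      rw [inv_pow, mul_inv_eq_one₀ (pow_ne_zero _ h0)] at h2
      exact h (hω.pow_inj hp hq h2)
    rw [geom_sum_eq hne]
    have : (ω ^ p * ω⁻¹ ^ q) ^ N = 1 := by
      rw [mul_pow, ← pow_mul, ← pow_mul, mul_comm p, mul_comm q, pow_mul, pow_mul, inv_pow,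
        hω.pow_eq_one]
      simp
    rw [this, sub_self, zero_div]

/-- Interpolation of the second moment between the first and the fourth, by two applications of
the Cauchy–Schwarz inequality through the third moment. -/
lemma sum_sq_cube_le {X : Type*} (s : Finset X) (q : X → ℝ) (hq : ∀ x ∈ s, 0 ≤ q x) :
    (∑ x ∈ s, q x ^ 2) ^ 3 ≤ (∑ x ∈ s, q x) ^ 2 * ∑ x ∈ s, q x ^ 4 := by
  set A1 := ∑ x ∈ s, q x
  set A2 := ∑ x ∈ s, q x ^ 2
  set A3 := ∑ x ∈ s, q x ^ 3
  set A4 := ∑ x ∈ s, q x ^ 4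
  have h1 : A2 ^ 2 ≤ A1 * A3 := sum_sq_le_sum_mul_sum_of_sq_le_mul _ hq
    (fun x hx => pow_nonneg (hq x hx) 3) (fun x _ => le_of_eq (by ring))
  have h2 : A3 ^ 2 ≤ A2 * A4 := sum_sq_le_sum_mul_sum_of_sq_le_mul _
    (fun x hx => pow_nonneg (hq x hx) 2) (fun x hx => pow_nonneg (hq x hx) 4)
    (fun x _ => le_of_eq (by ring))
  have p2 : 0 ≤ A2 := sum_nonneg fun x hx => pow_nonneg (hq x hx) 2
  have p4 : 0 ≤ A4 := sum_nonneg fun x hx => pow_nonneg (hq x hx) 4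
  rcases p2.eq_or_lt with h | h
  · rw [← h]; simp only [ne_eq, OfNat.ofNat_ne_zero, not_false_eq_true, zero_pow]; positivity
  · have h3 : A2 * A2 ^ 3 ≤ A2 * (A1 ^ 2 * A4) := by
      calc A2 * A2 ^ 3 = (A2 ^ 2) ^ 2 := by ring
        _ ≤ (A1 * A3) ^ 2 := by gcongr
        _ = A1 ^ 2 * A3 ^ 2 := by ring
        _ ≤ A1 ^ 2 * (A2 * A4) := by gcongr
        _ = _ := by ring
    exact le_of_mul_le_mul_left h3 h

variable {ι : Type*}

/-- The point `(ω ^ x₁, …, ω ^ xₙ)` of the torus. When `ω` is a primitive `N`-th root of unity and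
`x` runs through `ι → Fin N`, averages over these points replace integrals over the torus
for all polynomials of degree less than `N` in each variable. -/
def torusPoint {N : ℕ} (ω : ℂ) (x : ι → Fin N) : ι → ℂ := fun i => ω ^ (x i : ℕ)

lemma norm_torusPoint {N : ℕ} {ω : ℂ} (hω : ‖ω‖ = 1) (x : ι → Fin N) (i : ι) :
    ‖torusPoint ω x i‖ = 1 := by
  simp [torusPoint, hω]

variable [Fintype ι]

/-- The monomial `z ^ α = ∏ᵢ zᵢ ^ αᵢ` with multi-index `α`. -/
def monom {R : Type*} [CommMonoid R] (α : ι → ℕ) (z : ι → R) : R := ∏ i, z i ^ α i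

lemma monom_add {R : Type*} [CommMonoid R] (α β : ι → ℕ) (z : ι → R) :
    monom (α + β) z = monom α z * monom β z := by
  simp [monom, pow_add, prod_mul_distrib]

lemma monom_mul {R : Type*} [CommMonoid R] (α : ι → ℕ) (z w : ι → R) :
    monom α (z * w) = monom α z * monom α w := by
  simp [monom, mul_pow, prod_mul_distrib]

lemma norm_monom (α : ι → ℕ) (z : ι → ℂ) : ‖monom α z‖ = monom α fun i => ‖z i‖ := by
  simp [monom]

lemma norm_monom_torusPoint {N : ℕ} {ω : ℂ} (hω : ‖ω‖ = 1) (α : ι → ℕ) (x : ι → Fin N) :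
    ‖monom α (torusPoint ω x)‖ = 1 := by
  rw [norm_monom]
  simp [monom, norm_torusPoint hω]

variable [DecidableEq ι]

lemma monom_single {R : Type*} [CommMonoid R] (k : ι) (z : ι → R) :
    monom (Pi.single k 1) z = z k := by
  rw [monom, prod_eq_single k] <;> simp +contextual

/-- The homogeneous polynomial `∑ a_α z ^ α`, the sum running over all multi-indices `α` of
order `m`. -/
def homPoly (m : ℕ) (a : (ι → ℕ) → ℂ) (z : ι → ℂ) : ℂ :=
  ∑ α ∈ piAntidiag univ m, a α * monom α z

lemma le_of_mem_piAntidiag {m : ℕ} {α : ι → ℕ} (h : α ∈ piAntidiag univ m) (i : ι) : α i ≤ m := by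
  rw [mem_piAntidiag] at h
  rw [← h.1]
  exact single_le_sum (f := α) (fun _ _ => Nat.zero_le _) (mem_univ i)

/-- Orthogonality of the monomials on the finite torus. -/
lemma sum_monom_mul_conj {N : ℕ} {ω : ℂ} (hω : IsPrimitiveRoot ω N) (hn : ‖ω‖ = 1)
    {α β : ι → ℕ} (hα : ∀ i, α i < N) (hβ : ∀ i, β i < N) :
    ∑ x : ι → Fin N, monom α (torusPoint ω x) * conj (monom β (torusPoint ω x))
      = if α = β then (N : ℂ) ^ Fintype.card ι else 0 := by
  have h1 : ∀ x : ι → Fin N, monom α (torusPoint ω x) * conj (monom β (torusPoint ω x))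
      = ∏ i, ((ω ^ (x i : ℕ)) ^ α i * conj ((ω ^ (x i : ℕ)) ^ β i)) := by
    intro x
    simp [monom, torusPoint, prod_mul_distrib]
  simp_rw [h1]
  have h2 := Finset.prod_univ_sum (fun _ : ι => (univ : Finset (Fin N)))
    (fun i k => (ω ^ (k : ℕ)) ^ α i * conj ((ω ^ (k : ℕ)) ^ β i))
  rw [Fintype.piFinset_univ] at h2
  rw [← h2]
  simp_rw [sum_rootOfUnity hω hn (hα _) (hβ _)]
  split_ifs with h
  · subst h
    simp
  · obtain ⟨i, hi⟩ := Function.ne_iff.1 h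
    exact prod_eq_zero (mem_univ i) (by simp [hi])

lemma sum_poly_mul_conj_monom {N : ℕ} {ω : ℂ} (hω : IsPrimitiveRoot ω N) (hn : ‖ω‖ = 1)
    {S : Finset (ι → ℕ)} (hS : ∀ α ∈ S, ∀ i, α i < N) (b : (ι → ℕ) → ℂ) {β : ι → ℕ} (hβ : β ∈ S) :
    ∑ x : ι → Fin N, (∑ α ∈ S, b α * monom α (torusPoint ω x)) * conj (monom β (torusPoint ω x))
      = (N : ℂ) ^ Fintype.card ι * b β := by
  simp_rw [sum_mul]
  rw [sum_comm]
  simp_rw [mul_assoc, ← mul_sum]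
  rw [sum_eq_single β]
  · rw [sum_monom_mul_conj hω hn (hS β hβ) (hS β hβ), if_pos rfl, mul_comm]
  · intro α hα hne
    rw [sum_monom_mul_conj hω hn (hS α hα) (hS β hβ), if_neg hne, mul_zero]
  · exact fun h => absurd hβ h

/-- Parseval's identity on the finite torus. -/
lemma sum_norm_poly_sq {N : ℕ} {ω : ℂ} (hω : IsPrimitiveRoot ω N) (hn : ‖ω‖ = 1)
    {S : Finset (ι → ℕ)} (hS : ∀ α ∈ S, ∀ i, α i < N) (b : (ι → ℕ) → ℂ) :
    ∑ x : ι → Fin N, ‖∑ α ∈ S, b α * monom α (torusPoint ω x)‖ ^ 2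
      = (N : ℝ) ^ Fintype.card ι * ∑ α ∈ S, ‖b α‖ ^ 2 := by
  have h : ∑ x : ι → Fin N, (∑ α ∈ S, b α * monom α (torusPoint ω x)) *
      conj (∑ α ∈ S, b α * monom α (torusPoint ω x))
      = (N : ℂ) ^ Fintype.card ι * ∑ α ∈ S, b α * conj (b α) := by
    simp_rw [map_sum, map_mul, mul_sum (s := S)]
    rw [sum_comm]
    refine sum_congr rfl fun β hβ => ?_
    have := sum_poly_mul_conj_monom hω hn hS b hβ
    calc _ = conj (b β) * ∑ x : ι → Fin N, (∑ α ∈ S, b α * monom α (torusPoint ω x)) *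
          conj (monom β (torusPoint ω x)) := by
          rw [mul_sum]
          exact sum_congr rfl fun x _ => by ring
      _ = _ := by rw [this]; ring
  simp_rw [Complex.mul_conj'] at h
  exact_mod_cast h

/-- Coefficient estimate: a bound for a polynomial on the torus of radii `s` bounds
`|b_β| s ^ β`. -/
lemma norm_coeff_mul_monom_le {S : Finset (ι → ℕ)} (b : (ι → ℕ) → ℂ) {β : ι → ℕ} (hβ : β ∈ S)
    (s : ι → ℝ) {B : ℝ}
    (hB : ∀ z : ι → ℂ, (∀ i, ‖z i‖ = |s i|) → ‖∑ α ∈ S, b α * monom α z‖ ≤ B) :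
    ‖b β‖ * |monom β s| ≤ B := by
  obtain ⟨N, hN⟩ : ∃ N : ℕ, ∀ α ∈ S, ∀ i, α i < N := by
    refine ⟨(S.sup fun α => univ.sup α) + 1, fun α hα i => Nat.lt_succ_of_le ?_⟩
    exact (Finset.le_sup (f := α) (mem_univ i)).trans
      (Finset.le_sup (f := fun α : ι → ℕ => univ.sup α) hα)
  have hN' : ∀ α ∈ S, ∀ i, α i < N + 1 := fun α hα i => (hN α hα i).trans (Nat.lt_succ_self _)
  have hω := Complex.isPrimitiveRoot_exp (N + 1) (Nat.succ_ne_zero N)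
  set ω := Complex.exp (2 * Real.pi * Complex.I / ((N + 1 : ℕ) : ℂ))
  have hn : ‖ω‖ = 1 := Complex.norm_eq_one_of_pow_eq_one hω.pow_eq_one (Nat.succ_ne_zero N)
  have h := sum_poly_mul_conj_monom hω hn hN' (fun α => b α * monom α fun i => (s i : ℂ)) hβ
  have hs : ‖monom β fun i => (s i : ℂ)‖ = |monom β s| := by
    rw [norm_monom]; simp [monom, abs_prod]
  have hpos : (0 : ℝ) < ((N + 1 : ℕ) : ℝ) ^ Fintype.card ι := by positivity
  have h2 : ((N + 1 : ℕ) : ℝ) ^ Fintype.card ι * (‖b β‖ * |monom β s|)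
      ≤ ((N + 1 : ℕ) : ℝ) ^ Fintype.card ι * B := by
    have h3 := congrArg norm h
    rw [norm_mul, norm_mul, norm_pow, Complex.norm_natCast, hs] at h3
    rw [← h3]
    refine (norm_sum_le _ _).trans ?_
    have h4 : ∀ x : ι → Fin (N + 1), ‖(∑ α ∈ S, (b α * monom α fun i => (s i : ℂ)) *
        monom α (torusPoint ω x)) * conj (monom β (torusPoint ω x))‖ ≤ B := by
      intro x
      rw [norm_mul, RCLike.norm_conj, norm_monom_torusPoint hn, mul_one]
      have := hB ((fun i => (s i : ℂ)) * torusPoint ω x) fun i => by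
        simp [norm_torusPoint hn]
      simpa only [monom_mul, mul_assoc] using this
    refine (sum_le_sum fun x _ => h4 x).trans (le_of_eq ?_)
    simp
  exact le_of_mul_le_mul_left h2 hpos

/-- The square of a homogeneous polynomial satisfies an `ℓ²` coefficient bound, because a
multi-index `γ` of order `2m` has at most `∏ (γᵢ + 1) ≤ 2 ^ (2m)` decompositions `γ = α + β`. -/
lemma sum_norm_sq_coeff_sq_le (m : ℕ) (b : (ι → ℕ) → ℂ) :
    ∑ γ ∈ piAntidiag (univ : Finset ι) (2 * m),
      ‖∑ p ∈ piAntidiag (univ : Finset ι) m ×ˢ piAntidiag univ m with p.1 + p.2 = γ,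
        b p.1 * b p.2‖ ^ 2 ≤ 4 ^ m * (∑ α ∈ piAntidiag (univ : Finset ι) m, ‖b α‖ ^ 2) ^ 2 := by
  set S := piAntidiag (univ : Finset ι) m
  have hmap : ∀ p ∈ S ×ˢ S, p.1 + p.2 ∈ piAntidiag (univ : Finset ι) (2 * m) := by
    intro p hp
    simp only [S, mem_product, mem_piAntidiag] at hp
    simp [mem_piAntidiag, sum_add_distrib, hp.1.1, hp.2.1, two_mul]
  have hcard : ∀ γ ∈ piAntidiag (univ : Finset ι) (2 * m),
      #{p ∈ S ×ˢ S | p.1 + p.2 = γ} ≤ 4 ^ m := by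
    intro γ hγ
    rw [mem_piAntidiag] at hγ
    calc #{p ∈ S ×ˢ S | p.1 + p.2 = γ} ≤ #(Iic γ) := by
          refine card_le_card_of_injOn Prod.fst ?_ ?_
          · intro p hp
            simp only [coe_filter, Set.mem_ofPred_eq] at hp
            simp [← hp.2]
          · intro p hp q hq h
            simp only [coe_filter, Set.mem_ofPred_eq] at hp hq
            refine Prod.ext h ?_
            have := hp.2.trans hq.2.symm
            rw [h] at this
            exact add_left_cancel this
      _ = ∏ i, (γ i + 1) := by simp [Pi.card_Iic]
      _ ≤ ∏ i, 2 ^ γ i := prod_le_prod' fun i _ => Nat.lt_two_pow_self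
      _ = 4 ^ m := by rw [prod_pow_eq_pow_sum, hγ.1, pow_mul]; norm_num
  calc _ ≤ ∑ γ ∈ piAntidiag (univ : Finset ι) (2 * m),
        4 ^ m * ∑ p ∈ S ×ˢ S with p.1 + p.2 = γ, ‖b p.1‖ ^ 2 * ‖b p.2‖ ^ 2 := by
        refine sum_le_sum fun γ hγ => ?_
        calc _ ≤ (∑ p ∈ S ×ˢ S with p.1 + p.2 = γ, ‖b p.1 * b p.2‖) ^ 2 := by
              gcongr; exact norm_sum_le _ _
          _ ≤ #{p ∈ S ×ˢ S | p.1 + p.2 = γ} *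
              ∑ p ∈ S ×ˢ S with p.1 + p.2 = γ, ‖b p.1 * b p.2‖ ^ 2 := sq_sum_le_card_mul_sum_sq
          _ ≤ _ := by
              simp_rw [norm_mul, mul_pow]
              gcongr
              exact_mod_cast hcard γ hγ
    _ = 4 ^ m * ∑ p ∈ S ×ˢ S, ‖b p.1‖ ^ 2 * ‖b p.2‖ ^ 2 := by
        rw [← mul_sum, sum_fiberwise_of_maps_to hmap]
    _ = _ := by rw [sq (∑ α ∈ S, _), sum_mul_sum, sum_product]

/-- Comparison of the `L²` and the `L¹` norm of an `m`-homogeneous polynomial on the torus, with a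
constant which is exponential in `m` and independent of the number of variables. -/
lemma sqrt_sum_norm_sq_coeff_le {N : ℕ} {ω : ℂ} (hω : IsPrimitiveRoot ω N) (hn : ‖ω‖ = 1)
    {m : ℕ} (hN : 2 * m < N) (b : (ι → ℕ) → ℂ) :
    (N : ℝ) ^ Fintype.card ι * √(∑ α ∈ piAntidiag (univ : Finset ι) m, ‖b α‖ ^ 2)
      ≤ 2 ^ m * ∑ x : ι → Fin N, ‖homPoly m b (torusPoint ω x)‖ := by
  set S := piAntidiag (univ : Finset ι) m with hS
  have hSN : ∀ α ∈ S, ∀ i, α i < N := fun α hα i => by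
    have := le_of_mem_piAntidiag hα i; omega
  have hSN2 : ∀ α ∈ piAntidiag (univ : Finset ι) (2 * m), ∀ i, α i < N := fun α hα i => by
    have := le_of_mem_piAntidiag hα i; omega
  set K : ℝ := (N : ℝ) ^ Fintype.card ι with hK
  have hKpos : 0 < K := by
    have : (0 : ℝ) < N := by exact_mod_cast (by omega : 0 < N)
    positivity
  set E := ∑ α ∈ S, ‖b α‖ ^ 2 with hE
  have hE0 : 0 ≤ E := sum_nonneg fun _ _ => by positivity
  have h2 : ∑ x : ι → Fin N, ‖homPoly m b (torusPoint ω x)‖ ^ 2 = K * E :=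
    sum_norm_poly_sq hω hn hSN b
  have hsq : ∀ z : ι → ℂ, homPoly m b z ^ 2 = ∑ γ ∈ piAntidiag (univ : Finset ι) (2 * m),
      (∑ p ∈ S ×ˢ S with p.1 + p.2 = γ, b p.1 * b p.2) * monom γ z := by
    intro z
    have hmap : ∀ p ∈ S ×ˢ S, p.1 + p.2 ∈ piAntidiag (univ : Finset ι) (2 * m) := by
      intro p hp
      simp only [S, mem_product, mem_piAntidiag] at hp
      simp [mem_piAntidiag, sum_add_distrib, hp.1.1, hp.2.1, two_mul]
    rw [homPoly, sq, sum_mul_sum, ← sum_product', ← sum_fiberwise_of_maps_to hmap]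
    refine sum_congr rfl fun γ _ => ?_
    rw [sum_mul]
    refine sum_congr rfl fun p hp => ?_
    rw [← (mem_filter.1 hp).2, monom_add]
    ring
  -- the fourth moment is the second moment of the polynomial `homPoly m b ^ 2` of degree `2m < N`
  have h4 : ∑ x : ι → Fin N, ‖homPoly m b (torusPoint ω x)‖ ^ 4 ≤ K * (4 ^ m * E ^ 2) := by
    have : ∀ x : ι → Fin N, ‖homPoly m b (torusPoint ω x)‖ ^ 4
        = ‖homPoly m b (torusPoint ω x) ^ 2‖ ^ 2 := fun x => by rw [norm_pow]; ring
    simp_rw [this, hsq]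
    rw [sum_norm_poly_sq hω hn hSN2]
    exact mul_le_mul_of_nonneg_left (sum_norm_sq_coeff_sq_le m b) hKpos.le
  set A := ∑ x : ι → Fin N, ‖homPoly m b (torusPoint ω x)‖ with hA
  have hA0 : 0 ≤ A := sum_nonneg fun _ _ => norm_nonneg _
  have h5 := sum_sq_cube_le univ (fun x : ι → Fin N => ‖homPoly m b (torusPoint ω x)‖)
    (fun _ _ => norm_nonneg _)
  rw [h2, ← hA] at h5
  have h6 : (K * E) ^ 3 ≤ A ^ 2 * (K * (4 ^ m * E ^ 2)) :=
    h5.trans (mul_le_mul_of_nonneg_left h4 (by positivity))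
  rcases hE0.eq_or_lt with h | h
  · rw [← h]; simp; positivity
  have h7 : K ^ 2 * E ≤ (2 ^ m * A) ^ 2 := by
    have : (K * E ^ 2) * (K ^ 2 * E) ≤ (K * E ^ 2) * (2 ^ m * A) ^ 2 := by
      calc _ = (K * E) ^ 3 := by ring
        _ ≤ _ := h6
        _ = _ := by
          rw [show (4 : ℝ) ^ m = (2 ^ m) ^ 2 by rw [← pow_mul, mul_comm, pow_mul]; norm_num]; ring
    exact le_of_mul_le_mul_left this (by positivity)
  refine le_of_sq_le_sq ?_ (by positivity)
  rwa [mul_pow, Real.sq_sqrt hE0]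

end

/-! ### Coefficient estimates for homogeneous polynomials -/

section

open Finset

variable {ι : Type*} [Fintype ι] [DecidableEq ι]

/-- The coefficients of the directional derivative in direction `w` of the homogeneous polynomial
with coefficients `a`. -/
def dirCoeff (a : (ι → ℕ) → ℂ) (w : ι → ℂ) (α : ι → ℕ) : ℂ :=
  ∑ k, ((α k + 1 : ℕ) : ℂ) * a (α + Pi.single k 1) * w k

lemma homPoly_smul (m : ℕ) (a : (ι → ℕ) → ℂ) (c : ℂ) (z : ι → ℂ) :
    homPoly m a (c • z) = c ^ m * homPoly m a z := by
  rw [homPoly, homPoly, mul_sum]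
  refine sum_congr rfl fun α hα => ?_
  have : monom α (c • z) = c ^ m * monom α z := by
    rw [← (mem_piAntidiag.1 hα).1]
    simp [monom, mul_pow, prod_mul_distrib, prod_pow_eq_pow_sum]
  rw [this]; ring

lemma homPoly_mul_left (m : ℕ) (a : (ι → ℕ) → ℂ) (v z : ι → ℂ) :
    homPoly m a (v * z) = homPoly m (fun α => a α * monom α v) z := by
  simp only [homPoly, monom_mul, mul_assoc]

/-- The multi-indices `α` of order `m + 1` with `α k ≠ 0` are the `β + e_k` with `β` of
order `m`. -/
lemma sum_piAntidiag_succ (m : ℕ) (k : ι) (G : (ι → ℕ) → ℂ) (hG : ∀ α, α k = 0 → G α = 0) :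
    ∑ α ∈ piAntidiag univ (m + 1), G α = ∑ β ∈ piAntidiag univ m, G (β + Pi.single k 1) := by
  have h := sum_map (piAntidiag univ m) (addRightEmbedding (Pi.single k 1 : ι → ℕ)) G
  simp only [addRightEmbedding_apply] at h
  rw [← h]
  symm
  refine sum_subset ?_ ?_
  · intro α hα
    obtain ⟨β, hβ, rfl⟩ := mem_map.1 hα
    simp [mem_piAntidiag, sum_add_distrib, (mem_piAntidiag.1 hβ).1]
  · intro α hα hα'
    apply hG
    by_contra h0
    apply hα'
    have hle : Pi.single k 1 ≤ α := by
      intro i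
      rcases eq_or_ne i k with rfl | h
      · simpa using Nat.one_le_iff_ne_zero.2 h0
      · simp [h]
    refine mem_map.2 ⟨α - Pi.single k 1, ?_, by simpa using tsub_add_cancel_of_le hle⟩
    have h1 : ∑ i, α i = m + 1 := (mem_piAntidiag.1 hα).1
    have h2 : ∑ i, ((α - (Pi.single k 1 : ι → ℕ)) i + (Pi.single k 1 : ι → ℕ) i) = m + 1 := by
      rw [← h1]
      exact sum_congr rfl fun i _ => congrFun (tsub_add_cancel_of_le hle) i
    rw [sum_add_distrib] at h2
    simp only [sum_pi_single', mem_univ, if_true] at h2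
    simp only [mem_piAntidiag, mem_univ, implies_true, and_true]
    exact Nat.succ_injective h2

lemma hasDerivAt_monom (α : ι → ℕ) (z w : ι → ℂ) :
    HasDerivAt (fun t : ℂ => monom α (z + t • w))
      (∑ k, (α k : ℂ) * w k * monom (α - Pi.single k 1) z) 0 := by
  have h : ∀ i ∈ (univ : Finset ι), HasDerivAt (fun t : ℂ => (z i + t * w i) ^ α i)
      ((α i : ℂ) * (z i) ^ (α i - 1) * w i) 0 := by
    intro i _
    have := (((hasDerivAt_id (0 : ℂ)).mul_const (w i)).const_add (z i)).pow (α i)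
    refine (this.congr_deriv (by simp)).congr_of_eventuallyEq ?_
    exact Filter.Eventually.of_forall fun t => by simp
  have h2 := HasDerivAt.fun_finsetProd h
  refine h2.congr_deriv (sum_congr rfl fun k _ => ?_)
  have h3 : monom (α - Pi.single k 1) z = z k ^ (α k - 1) * ∏ j ∈ univ.erase k, z j ^ α j := by
    rw [monom, ← mul_prod_erase univ _ (mem_univ k)]
    congr 1
    · simp
    · refine prod_congr rfl fun j hj => ?_
      simp [(mem_erase.1 hj).1]
  rw [h3]
  simp only [zero_mul, add_zero, smul_eq_mul]
  ring

lemma hasDerivAt_homPoly (m : ℕ) (a : (ι → ℕ) → ℂ) (z w : ι → ℂ) :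
    HasDerivAt (fun t : ℂ => homPoly (m + 1) a (z + t • w)) (homPoly m (dirCoeff a w) z) 0 := by
  have h := HasDerivAt.fun_sum fun α (_ : α ∈ piAntidiag (univ : Finset ι) (m + 1)) =>
    (hasDerivAt_monom α z w).const_mul (a α)
  refine h.congr_deriv ?_
  simp_rw [homPoly, dirCoeff, mul_sum, sum_mul]
  rw [sum_comm, sum_comm (s := piAntidiag univ m)]
  refine sum_congr rfl fun k _ => ?_
  rw [sum_piAntidiag_succ m k _ fun α hα => by simp [hα]]
  refine sum_congr rfl fun β _ => ?_
  simp only [Pi.add_apply, Pi.single_eq_same, add_tsub_cancel_right]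
  ring

/-- The Cauchy estimate for the derivative at `0` of `t ↦ P (z + t w)` on the unit disc. -/
lemma norm_homPoly_dirCoeff_le (m : ℕ) (a : (ι → ℕ) → ℂ) (z w : ι → ℂ) {B : ℝ}
    (hB : ∀ t : ℂ, ‖t‖ = 1 → ‖homPoly (m + 1) a (z + t • w)‖ ≤ B) :
    ‖homPoly m (dirCoeff a w) z‖ ≤ B := by
  have hd : Differentiable ℂ fun t : ℂ => homPoly (m + 1) a (z + t • w) := by
    unfold homPoly monom
    simp only [Pi.add_apply, Pi.smul_apply, smul_eq_mul]
    fun_prop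
  have := Complex.norm_deriv_le_of_forall_mem_sphere_norm_le (c := 0) (R := 1) (C := B) one_pos
    hd.diffContOnCl (fun t ht => hB t (by simpa using ht))
  rwa [(hasDerivAt_homPoly m a z w).deriv, div_one] at this

/-- Every complex number can be rotated to its modulus. -/
lemma exists_phase (x : ℂ) : ∃ ε : ℂ, ‖ε‖ = 1 ∧ x * ε = ‖x‖ := by
  rcases eq_or_ne x 0 with rfl | h
  · exact ⟨1, by simp, by simp⟩
  · have hx : (‖x‖ : ℂ) ≠ 0 := by exact_mod_cast norm_ne_zero_iff.2 h
    refine ⟨‖x‖ / x, ?_, by field_simp⟩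
    simp [h]

lemma dirCoeff_single (a : (ι → ℕ) → ℂ) (k : ι) (α : ι → ℕ) :
    dirCoeff a (Pi.single k 1) α = ((α k + 1 : ℕ) : ℂ) * a (α + Pi.single k 1) := by
  rw [dirCoeff, sum_eq_single k] <;> simp +contextual

lemma homPoly_dirCoeff_eq_sum (m : ℕ) (a : (ι → ℕ) → ℂ) (z w : ι → ℂ) :
    homPoly m (dirCoeff a w) z = ∑ k, homPoly m (dirCoeff a (Pi.single k 1)) z * w k := by
  simp_rw [homPoly, dirCoeff_single, dirCoeff, sum_mul]
  rw [sum_comm]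
  exact sum_congr rfl fun k _ => sum_congr rfl fun α _ => by ring

lemma norm_le_norm_natCast_succ_mul (p : ℕ) (x : ℂ) : ‖x‖ ≤ ‖((p + 1 : ℕ) : ℂ) * x‖ := by
  rw [norm_mul, Complex.norm_natCast]
  refine le_mul_of_one_le_left (norm_nonneg _) ?_
  exact_mod_cast Nat.succ_le_succ (Nat.zero_le p)

/-- The coefficient estimate on the polydisc. The Cauchy–Schwarz inequality over `T` leads to the
`ℓ²` norms of the coefficients of the partial derivatives, which are bounded by `L¹` norms; and
the sum of the moduli of all partial derivatives at a point is a single directional derivative. -/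
lemma sum_coeff_le_of_polydisc (m : ℕ) (a : (ι → ℕ) → ℂ) {B : ℝ}
    (hB : ∀ z : ι → ℂ, (∀ i, ‖z i‖ ≤ 1) → ‖homPoly (m + 1) a z‖ ≤ B)
    {T : Finset (ι → ℕ)} (hT : T ⊆ piAntidiag univ m) :
    ∑ α ∈ T, ∑ k, ‖a (α + Pi.single k 1)‖ ≤ 2 ^ m * 2 ^ (m + 1) * √(#T) * B := by
  -- `N > 2m`, as the comparison of norms involves squares of polynomials of degree `m`
  set N := 2 * m + 1 with hN
  have hω := Complex.isPrimitiveRoot_exp N (Nat.succ_ne_zero _)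
  set ω := Complex.exp (2 * Real.pi * Complex.I / (N : ℂ))
  have hn : ‖ω‖ = 1 := Complex.norm_eq_one_of_pow_eq_one hω.pow_eq_one (Nat.succ_ne_zero _)
  set K : ℝ := (N : ℝ) ^ Fintype.card ι with hK
  have hK0 : 0 < K := by rw [hK, hN]; positivity
  have h1 : ∀ k, K * ∑ α ∈ T, ‖a (α + Pi.single k 1)‖ ≤ √(#T) * (2 ^ m *
      ∑ x : ι → Fin N, ‖homPoly m (dirCoeff a (Pi.single k 1)) (torusPoint ω x)‖) := by
    intro k
    have h2 := sqrt_sum_norm_sq_coeff_le hω hn (m := m) (by omega) (dirCoeff a (Pi.single k 1))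
    have h3 : ∑ α ∈ T, ‖a (α + Pi.single k 1)‖ ≤ √(#T) *
        √(∑ α ∈ piAntidiag (univ : Finset ι) m, ‖dirCoeff a (Pi.single k 1) α‖ ^ 2) := by
      rw [← Real.sqrt_mul (Nat.cast_nonneg _)]
      refine Real.le_sqrt_of_sq_le ((sq_sum_le_card_mul_sum_sq).trans ?_)
      refine mul_le_mul_of_nonneg_left ?_ (Nat.cast_nonneg _)
      refine (sum_le_sum fun α _ => ?_).trans
        (sum_le_sum_of_subset_of_nonneg hT fun _ _ _ => by positivity)
      rw [dirCoeff_single]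
      gcongr
      exact norm_le_norm_natCast_succ_mul _ _
    calc _ ≤ K * (√(#T) * _) := mul_le_mul_of_nonneg_left h3 hK0.le
      _ = √(#T) * (K * _) := by ring
      _ ≤ _ := mul_le_mul_of_nonneg_left h2 (Real.sqrt_nonneg _)
  have h4 : ∀ x : ι → Fin N, ∑ k, ‖homPoly m (dirCoeff a (Pi.single k 1)) (torusPoint ω x)‖
      ≤ 2 ^ (m + 1) * B := by
    intro x
    choose ε hε1 hε2 using fun k => exists_phase
      (homPoly m (dirCoeff a (Pi.single k 1)) (torusPoint ω x))
    have h5 := homPoly_dirCoeff_eq_sum m a (torusPoint ω x) ε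
    simp_rw [hε2] at h5
    have h6 : ‖homPoly m (dirCoeff a ε) (torusPoint ω x)‖ ≤ 2 ^ (m + 1) * B := by
      refine norm_homPoly_dirCoeff_le m a _ _ fun t ht => ?_
      -- half of `z + t w` lies in the polydisc; homogeneity costs the factor `2 ^ (m + 1)`
      have h7 : torusPoint ω x + t • ε = (2 : ℂ) • ((2⁻¹ : ℂ) • (torusPoint ω x + t • ε)) := by
        rw [smul_smul]; norm_num
      rw [h7, homPoly_smul, norm_mul, norm_pow, Complex.norm_two]
      refine mul_le_mul_of_nonneg_left (hB _ fun i => ?_) (by positivity)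
      have h8 : ‖torusPoint ω x i + t * ε i‖ ≤ 1 + 1 := by
        refine (norm_add_le _ _).trans ?_
        rw [norm_torusPoint hn, norm_mul, ht, hε1, one_mul]
      simp only [Pi.smul_apply, Pi.add_apply, smul_eq_mul, norm_mul, norm_inv, Complex.norm_two]
      linarith
    rw [h5, ← Complex.ofReal_sum, Complex.norm_real, Real.norm_of_nonneg
      (sum_nonneg fun _ _ => norm_nonneg _)] at h6
    exact h6
  have h9 : K * ∑ α ∈ T, ∑ k, ‖a (α + Pi.single k 1)‖
      ≤ K * (2 ^ m * 2 ^ (m + 1) * √(#T) * B) := by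
    rw [sum_comm, mul_sum]
    calc _ ≤ ∑ k, √(#T) * (2 ^ m *
          ∑ x : ι → Fin N, ‖homPoly m (dirCoeff a (Pi.single k 1)) (torusPoint ω x)‖) :=
          sum_le_sum fun k _ => h1 k
      _ = √(#T) * (2 ^ m * ∑ x : ι → Fin N,
          ∑ k, ‖homPoly m (dirCoeff a (Pi.single k 1)) (torusPoint ω x)‖) := by
          rw [← mul_sum, ← mul_sum, sum_comm]
      _ ≤ √(#T) * (2 ^ m * ∑ x : ι → Fin N, 2 ^ (m + 1) * B) := by
          gcongr with x
          exact h4 x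
      _ = _ := by
          simp [hK]
          ring
  exact le_of_mul_le_mul_left h9 hK0

/-- A consequence of `mᵐ ≤ eᵐ m!` and `α! ≤ ∏ αᵢ ^ αᵢ`. -/
lemma one_le_multinomial_mul {m : ℕ} {α : ι → ℕ} (hα : α ∈ piAntidiag univ m) :
    1 ≤ (∏ i, ((α i : ℝ) / m) ^ α i) * (Real.exp m * Nat.multinomial univ α) := by
  have hs : ∑ i, α i = m := (mem_piAntidiag.1 hα).1
  rcases Nat.eq_zero_or_pos m with rfl | hm
  · have : α = 0 := by
      ext i
      exact Nat.le_zero.1 (le_of_mem_piAntidiag hα i)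
    subst this
    simp [Nat.multinomial]
  have hm' : (0 : ℝ) < m := by exact_mod_cast hm
  have h1 : (∏ i, ((α i).factorial : ℝ)) * Nat.multinomial univ α = (m.factorial : ℝ) := by
    rw [← hs]; exact_mod_cast Nat.multinomial_spec univ α
  have h2 : (∏ i, ((α i).factorial : ℝ)) ≤ ∏ i, (α i : ℝ) ^ α i :=
    prod_le_prod (fun _ _ => by positivity) fun i _ => by exact_mod_cast Nat.factorial_le_pow _
  have h3 : (m : ℝ) ^ m ≤ Real.exp m * m.factorial := by
    have := Real.pow_div_factorial_le_exp (x := (m : ℝ)) hm'.le m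
    rwa [div_le_iff₀ (by positivity)] at this
  have h4 : ∏ i, ((α i : ℝ) / m) ^ α i = (∏ i, (α i : ℝ) ^ α i) / (m : ℝ) ^ m := by
    rw [prod_congr rfl fun i _ => div_pow (α i : ℝ) m (α i), prod_div_distrib,
      prod_pow_eq_pow_sum, hs]
  rw [h4, div_mul_eq_mul_div, le_div_iff₀ (by positivity), one_mul]
  calc (m : ℝ) ^ m ≤ Real.exp m * m.factorial := h3
    _ = (∏ i, ((α i).factorial : ℝ)) * (Real.exp m * Nat.multinomial univ α) := by
        rw [← h1]; ring
    _ ≤ _ := by gcongr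

/-- Hölder's inequality over `T`, combined with
`∑_α (m! / α!) (v ^ α) ^ p = (∑ vᵢ ^ p) ^ m` (the multinomial theorem). -/
lemma sum_multinomial_rpow_le {p : ℝ} (hp : 1 ≤ p) {m : ℕ} {v : ι → ℝ} (hv0 : ∀ i, 0 ≤ v i)
    (hv : ∑ i, v i ^ p ≤ 1) {T : Finset (ι → ℕ)} (hT : T ⊆ piAntidiag univ m) :
    ∑ α ∈ T, monom α v * (Nat.multinomial univ α : ℝ) ^ (1 / p) ≤ (#T : ℝ) ^ (1 - 1 / p) := by
  have hp0 : 0 < p := by linarith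
  have hm0 : ∀ α, 0 ≤ monom α v := fun α => prod_nonneg fun i _ => pow_nonneg (hv0 i) _
  have h1 := Real.rpow_sum_le_const_mul_sum_rpow T
    (fun α => monom α v * (Nat.multinomial univ α : ℝ) ^ (1 / p)) hp
  have hnn : ∀ α, 0 ≤ monom α v * (Nat.multinomial univ α : ℝ) ^ (1 / p) :=
    fun α => mul_nonneg (hm0 α) (by positivity)
  simp_rw [abs_of_nonneg (hnn _)] at h1
  have h2 : ∑ α ∈ T, (monom α v * (Nat.multinomial univ α : ℝ) ^ (1 / p)) ^ p ≤ 1 := by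
    have h3 : ∀ α, (monom α v * (Nat.multinomial univ α : ℝ) ^ (1 / p)) ^ p
        = Nat.multinomial univ α * ∏ i, (v i ^ p) ^ α i := by
      intro α
      rw [Real.mul_rpow (hm0 α) (by positivity), ← Real.rpow_mul (by positivity),
        one_div_mul_cancel hp0.ne', Real.rpow_one, mul_comm, monom,
        ← Real.finsetProd_rpow _ _ fun i _ => pow_nonneg (hv0 i) _]
      congr 1
      refine prod_congr rfl fun i _ => ?_
      rw [← Real.rpow_natCast, ← Real.rpow_natCast, ← Real.rpow_mul (hv0 i),
        ← Real.rpow_mul (hv0 i), mul_comm]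
    simp_rw [h3]
    have hvp : ∀ i, 0 ≤ v i ^ p := fun i => Real.rpow_nonneg (hv0 i) p
    calc _ ≤ ∑ α ∈ piAntidiag univ m, (Nat.multinomial univ α : ℝ) * ∏ i, (v i ^ p) ^ α i :=
          sum_le_sum_of_subset_of_nonneg hT fun α _ _ =>
            mul_nonneg (Nat.cast_nonneg _) (prod_nonneg fun i _ => pow_nonneg (hvp i) _)
      _ = (∑ i, v i ^ p) ^ m := (sum_pow_eq_sum_piAntidiag univ (fun i => v i ^ p) m).symm
      _ ≤ 1 := pow_le_one₀ (sum_nonneg fun i _ => hvp i) hv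
  have h4 : (∑ α ∈ T, monom α v * (Nat.multinomial univ α : ℝ) ^ (1 / p)) ^ p
      ≤ (#T : ℝ) ^ (p - 1) := h1.trans (mul_le_of_le_one_right (by positivity) h2)
  have h5 := Real.rpow_le_rpow (Real.rpow_nonneg (sum_nonneg fun α _ => hnn α) p) h4
    (by positivity : 0 ≤ 1 / p)
  rw [← Real.rpow_mul (sum_nonneg fun α _ => hnn α), mul_one_div_cancel hp0.ne', Real.rpow_one,
    ← Real.rpow_mul (Nat.cast_nonneg _)] at h5
  convert h5 using 2
  field_simp

/-- The coefficient estimate on the ball of `ℓ_p`. For a fixed multi-index `α` the coefficient of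
`z ^ α` in a directional derivative is bounded by means of the Cauchy estimate at the point of
the unit sphere where `|z ^ α|` is maximal. Hölder's inequality allows for summation over `T`. -/
lemma sum_coeff_le_of_lpBall {p : ℝ} (hp : 1 ≤ p) (m : ℕ) (a : (ι → ℕ) → ℂ) {B : ℝ}
    (hB : ∀ z : ι → ℂ, ∑ i, ‖z i‖ ^ p ≤ 1 → ‖homPoly (m + 1) a z‖ ≤ B)
    {v : ι → ℂ} (hv : ∑ i, ‖v i‖ ^ p ≤ 1)
    {T : Finset (ι → ℕ)} (hT : T ⊆ piAntidiag univ m) :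
    ∑ α ∈ T, ∑ k, ‖a (α + Pi.single k 1) * monom (α + Pi.single k 1) v‖
      ≤ 2 ^ (m + 1) * Real.exp m * (#T : ℝ) ^ (1 - 1 / p) * B := by
  have hp0 : 0 < p := by linarith
  have hB0 : 0 ≤ B := (norm_nonneg _).trans (hB 0 (by simp [Real.zero_rpow hp0.ne']))
  have h2B : ∀ z w : ι → ℂ, ∑ i, ‖z i‖ ^ p ≤ 1 → ∑ i, ‖w i‖ ^ p ≤ 1 →
      ‖homPoly m (dirCoeff a w) z‖ ≤ 2 ^ (m + 1) * B := by
    intro z w hz hw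
    refine norm_homPoly_dirCoeff_le m a _ _ fun t ht => ?_
    -- half of `z + t w` lies in the ball, which is convex
    have h7 : z + t • w = (2 : ℂ) • ((2⁻¹ : ℂ) • (z + t • w)) := by
      rw [smul_smul]; norm_num
    rw [h7, homPoly_smul, norm_mul, norm_pow, Complex.norm_two]
    refine mul_le_mul_of_nonneg_left (hB _ ?_) (by positivity)
    have h8 : ∀ i, ‖((2⁻¹ : ℂ) • (z + t • w)) i‖ ^ p
        ≤ 2⁻¹ * ‖z i‖ ^ p + 2⁻¹ * ‖w i‖ ^ p := by
      intro i
      have h9 : ‖((2⁻¹ : ℂ) • (z + t • w)) i‖ ≤ 2⁻¹ * ‖z i‖ + 2⁻¹ * ‖w i‖ := by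
        simp only [Pi.smul_apply, Pi.add_apply, smul_eq_mul, norm_mul, norm_inv, Complex.norm_two]
        have := norm_add_le (z i) (t * w i)
        rw [norm_mul, ht, one_mul] at this
        linarith
      refine (Real.rpow_le_rpow (norm_nonneg _) h9 hp0.le).trans ?_
      have h2 : (0 : ℝ) ≤ 2⁻¹ := by norm_num
      have := (convexOn_rpow hp).2 (norm_nonneg (z i)) (norm_nonneg (w i)) h2 h2 (by norm_num)
      simpa only [smul_eq_mul] using this
    refine (sum_le_sum fun i _ => h8 i).trans ?_
    rw [sum_add_distrib, ← mul_sum, ← mul_sum]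
    linarith
  have hα : ∀ α ∈ piAntidiag univ m, ∑ k, ‖a (α + Pi.single k 1)‖ * ‖v k‖
      ≤ 2 ^ (m + 1) * B * (Real.exp m * Nat.multinomial univ α) ^ (1 / p) := by
    intro α hα
    -- a direction `w` with `|w_k| = |v_k|` for which no cancellation occurs in `b_α(w)`
    choose ε hε1 hε2 using fun k => exists_phase (a (α + Pi.single k 1))
    set w : ι → ℂ := fun k => ε k * ‖v k‖ with hw
    have hw1 : ∑ i, ‖w i‖ ^ p ≤ 1 := by simpa [hw, hε1] using hv
    have h10 : ∑ k, ‖a (α + Pi.single k 1)‖ * ‖v k‖ ≤ ‖dirCoeff a w α‖ := by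
      have h11 : dirCoeff a w α
          = ((∑ k, ((α k + 1 : ℕ) : ℝ) * (‖a (α + Pi.single k 1)‖ * ‖v k‖) : ℝ) : ℂ) := by
        rw [dirCoeff, Complex.ofReal_sum]
        refine sum_congr rfl fun k _ => ?_
        rw [hw]
        push_cast
        rw [← hε2]; ring
      rw [h11, Complex.norm_real]
      refine le_trans (sum_le_sum fun k _ => ?_) (le_abs_self _)
      refine le_mul_of_one_le_left (by positivity) ?_
      exact_mod_cast Nat.succ_le_succ (Nat.zero_le _)
    -- the point of the unit sphere at which `|z ^ α|` attains its maximum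
    -- (for `m = 0` the quotient `0 / 0` is `0`, and `s = 0` serves as well since `α = 0`)
    set s : ι → ℝ := fun i => ((α i : ℝ) / m) ^ (1 / p) with hs
    have hs0 : ∀ i, 0 ≤ s i := fun i => by positivity
    have hsp : ∀ i, s i ^ p = (α i : ℝ) / m := fun i => by
      rw [hs, ← Real.rpow_mul (by positivity), one_div_mul_cancel hp0.ne', Real.rpow_one]
    have hs1 : ∑ i, s i ^ p ≤ 1 := by
      simp_rw [hsp]
      rw [← sum_div]
      have : ((∑ i, (α i : ℝ)) : ℝ) = m := by exact_mod_cast (mem_piAntidiag.1 hα).1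
      rw [this]
      exact div_self_le_one _
    have h12 : ‖dirCoeff a w α‖ * |monom α s| ≤ 2 ^ (m + 1) * B := by
      refine norm_coeff_mul_monom_le (dirCoeff a w) hα s fun z hz => h2B z w ?_ hw1
      simp_rw [hz, abs_of_nonneg (hs0 _)]
      exact hs1
    have h13 : 1 ≤ |monom α s| * (Real.exp m * Nat.multinomial univ α) ^ (1 / p) := by
      have h14 : monom α s = (∏ i, ((α i : ℝ) / m) ^ α i) ^ (1 / p) := by
        rw [monom, ← Real.finsetProd_rpow _ _ fun i _ => by positivity]
        refine prod_congr rfl fun i _ => ?_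
        rw [hs, ← Real.rpow_natCast, ← Real.rpow_natCast, ← Real.rpow_mul (by positivity),
          ← Real.rpow_mul (by positivity), mul_comm]
      rw [h14, abs_of_nonneg (by positivity), ← Real.mul_rpow (by positivity) (by positivity)]
      exact Real.one_le_rpow (one_le_multinomial_mul hα) (by positivity)
    calc _ ≤ ‖dirCoeff a w α‖ := h10
      _ ≤ ‖dirCoeff a w α‖ * (|monom α s| * (Real.exp m * Nat.multinomial univ α) ^ (1 / p)) :=
          le_mul_of_one_le_right (norm_nonneg _) h13
      _ = ‖dirCoeff a w α‖ * |monom α s| * (Real.exp m * Nat.multinomial univ α) ^ (1 / p) := by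
          ring
      _ ≤ _ := by gcongr
  have hv' : ∑ α ∈ T, (monom α fun i => ‖v i‖) * (Nat.multinomial univ α : ℝ) ^ (1 / p)
      ≤ (#T : ℝ) ^ (1 - 1 / p) := sum_multinomial_rpow_le hp (fun i => norm_nonneg (v i)) hv hT
  have he : Real.exp m ^ (1 / p) ≤ Real.exp m :=
    Real.rpow_le_self_of_one_le (Real.one_le_exp (Nat.cast_nonneg m)) ((div_le_one hp0).2 hp)
  calc _ = ∑ α ∈ T, (monom α fun i => ‖v i‖) * ∑ k, ‖a (α + Pi.single k 1)‖ * ‖v k‖ := by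
        refine sum_congr rfl fun α _ => ?_
        rw [mul_sum]
        refine sum_congr rfl fun k _ => ?_
        rw [norm_mul, norm_monom, monom_add, monom_single]; ring
    _ ≤ ∑ α ∈ T, (monom α fun i => ‖v i‖) *
        (2 ^ (m + 1) * B * (Real.exp m * Nat.multinomial univ α) ^ (1 / p)) := by
        refine sum_le_sum fun α hα' => mul_le_mul_of_nonneg_left (hα α (hT hα')) ?_
        exact prod_nonneg fun i _ => by positivity
    _ = 2 ^ (m + 1) * B * Real.exp m ^ (1 / p) *
        ∑ α ∈ T, (monom α fun i => ‖v i‖) * (Nat.multinomial univ α : ℝ) ^ (1 / p) := by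
        rw [mul_sum]
        refine sum_congr rfl fun α _ => ?_
        rw [Real.mul_rpow (by positivity) (by positivity)]; ring
    _ ≤ 2 ^ (m + 1) * B * Real.exp m * (#T : ℝ) ^ (1 - 1 / p) :=
        mul_le_mul (mul_le_mul_of_nonneg_left he (by positivity)) hv'
          (sum_nonneg fun α _ => mul_nonneg (prod_nonneg fun i _ => by positivity) (by positivity))
          (by positivity)
    _ = _ := by ring

end

section

open Finset Metric Filter Topology

/-! ### Smoothness of holomorphic functions of several variables -/

section Smoothness

variable {E : Type*} [NormedAddCommGroup E] [NormedSpace ℂ E]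

lemma hasDerivAt_comp_line {f : E → ℂ} {y w : E} {t : ℂ} (hf : DifferentiableAt ℂ f (y + t • w)) :
    HasDerivAt (fun t : ℂ => f (y + t • w)) (fderiv ℂ f (y + t • w) w) t := by
  have h : HasDerivAt (fun t : ℂ => y + t • w) w t := by
    simpa using ((hasDerivAt_id t).smul_const w).const_add y
  exact hf.hasFDerivAt.comp_hasDerivAt t h

lemma norm_fderiv_le_of_ball {f : E → ℂ} {y : E} {r M : ℝ} (hr : 0 < r)
    (hf : ∀ x, ‖x - y‖ ≤ r → DifferentiableAt ℂ f x) (hM : ∀ x, ‖x - y‖ ≤ r → ‖f x‖ ≤ M) :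
    ‖fderiv ℂ f y‖ ≤ M / r := by
  have hM0 : 0 ≤ M := (norm_nonneg _).trans (hM y (by simpa using hr.le))
  refine ContinuousLinearMap.opNorm_le_bound _ (by positivity) fun w => ?_
  rcases eq_or_ne w 0 with rfl | hw
  · simp
  have hw' : 0 < ‖w‖ := norm_pos_iff.2 hw
  have hmem : ∀ t ∈ closedBall (0 : ℂ) (r / ‖w‖), ‖y + t • w - y‖ ≤ r := by
    intro t ht
    rw [mem_closedBall_zero_iff, le_div_iff₀ hw'] at ht
    simpa [norm_smul] using ht
  have hd : DifferentiableOn ℂ (fun t : ℂ => f (y + t • w)) (closedBall 0 (r / ‖w‖)) := fun t ht =>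
    (hasDerivAt_comp_line (hf _ (hmem t ht))).differentiableAt.differentiableWithinAt
  have h0 : (0 : ℂ) ∈ closedBall (0 : ℂ) (r / ‖w‖) := mem_closedBall_self (by positivity)
  have h := Complex.norm_deriv_le_of_forall_mem_sphere_norm_le (c := 0) (R := r / ‖w‖) (C := M)
    (by positivity) ((hd.mono closure_ball_subset_closedBall).diffContOnCl)
    (fun t ht => hM _ (hmem t (sphere_subset_closedBall ht)))
  rw [(hasDerivAt_comp_line (hf _ (hmem 0 h0))).deriv, zero_smul, add_zero] at h
  rw [div_div_eq_mul_div] at h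
  rwa [div_mul_eq_mul_div]

/-- Directional derivatives of a holomorphic function of several variables are holomorphic: the
Cauchy integral formula on a complex line can be differentiated under the integral sign. -/
lemma differentiableOn_fderiv_apply [FiniteDimensional ℂ E] {f : E → ℂ} {U : Set E}
    (hU : IsOpen U) (hf : DifferentiableOn ℂ f U) (v : E) :
    DifferentiableOn ℂ (fun x => fderiv ℂ f x v) U := by
  intro x₀ hx₀
  refine DifferentiableAt.differentiableWithinAt ?_
  have hfa : ∀ x ∈ U, DifferentiableAt ℂ f x := fun x hx => hf.differentiableAt (hU.mem_nhds hx)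
  obtain ⟨δ, hδ, hball⟩ : ∃ δ > 0, ball x₀ δ ⊆ U ∩ {x | ‖f x‖ < ‖f x₀‖ + 1} := by
    refine Metric.mem_nhds_iff.1 (inter_mem (hU.mem_nhds hx₀) ?_)
    exact (hfa x₀ hx₀).continuousAt.norm.eventually_lt_const (lt_add_one _)
  -- lines through points of `ball x₀ r` stay in `ball x₀ (2 * r)`, where `fderiv ℂ f` is bounded by
  -- the Cauchy estimate on balls of radius `r`
  set M := ‖f x₀‖ + 1
  set r := δ / 4 with hr
  have hr0 : 0 < r := by positivity
  have hmem : ∀ x, ‖x - x₀‖ < 4 * r → x ∈ U ∧ ‖f x‖ ≤ M := by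
    intro x hx
    have := hball (mem_ball_iff_norm.2 (by linarith : ‖x - x₀‖ < δ))
    exact ⟨this.1, (show ‖f x‖ < M from this.2).le⟩
  -- `‖v‖ + 1` instead of `‖v‖` covers `v = 0`
  set ρ := r / (‖v‖ + 1) with hρ
  have hρ0 : 0 < ρ := by positivity
  have hρv : ∀ t : ℂ, ‖t‖ ≤ ρ → ‖t • v‖ ≤ r := by
    intro t ht
    rw [norm_smul]
    calc ‖t‖ * ‖v‖ ≤ ρ * (‖v‖ + 1) := by gcongr; linarith
      _ = r := by rw [hρ]; field_simp
  have hline : ∀ y ∈ ball x₀ r, ∀ t : ℂ, ‖t‖ ≤ ρ → ‖y + t • v - x₀‖ < 2 * r := by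
    intro y hy t ht
    rw [mem_ball_iff_norm] at hy
    calc ‖y + t • v - x₀‖ = ‖(y - x₀) + t • v‖ := by congr 1; abel
      _ ≤ ‖y - x₀‖ + ‖t • v‖ := norm_add_le _ _
      _ < 2 * r := by linarith [hρv t ht]
  have hfd : ∀ x, ‖x - x₀‖ < 2 * r → ‖fderiv ℂ f x‖ ≤ M / r := by
    intro x hx
    have h : ∀ y, ‖y - x‖ ≤ r → ‖y - x₀‖ < 4 * r := by
      intro y hy
      calc ‖y - x₀‖ = ‖(y - x) + (x - x₀)‖ := by congr 1; abel
        _ ≤ ‖y - x‖ + ‖x - x₀‖ := norm_add_le _ _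
        _ < 4 * r := by linarith
    exact norm_fderiv_le_of_ball hr0 (fun y hy => hfa y (hmem y (h y hy)).1)
      fun y hy => (hmem y (h y hy)).2
  set c : ℝ → ℂ := fun θ => deriv (circleMap 0 ρ) θ * (1 / (circleMap 0 ρ θ) ^ 2) with hc
  have hcirc : ∀ θ, ‖circleMap 0 ρ θ‖ = ρ := fun θ => by simp [abs_of_pos hρ0]
  have hcc : Continuous c := by
    have : ∀ θ, circleMap 0 ρ θ ≠ 0 := fun θ => by
      rw [← norm_ne_zero_iff, hcirc]; exact hρ0.ne'
    simp only [hc, deriv_circleMap]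
    refine ((continuous_circleMap 0 ρ).mul continuous_const).mul (continuous_const.div
      ((continuous_circleMap 0 ρ).pow 2) fun θ => pow_ne_zero _ (this θ))
  have hcn : ∀ θ, ‖c θ‖ = ρ⁻¹ := fun θ => by
    simp only [hc, deriv_circleMap, norm_mul, norm_div, norm_pow, hcirc, norm_one, Complex.norm_I]
    field_simp
  have hformula : ∀ y ∈ ball x₀ r, fderiv ℂ f y v = (2 * Real.pi * Complex.I)⁻¹ *
      ∫ θ in (0 : ℝ)..2 * Real.pi, c θ * f (y + circleMap 0 ρ θ • v) := by
    intro y hy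
    have hd : DifferentiableOn ℂ (fun t : ℂ => f (y + t • v)) (closedBall 0 ρ) := fun t ht =>
      (hasDerivAt_comp_line (hfa _ (hmem _ ((hline y hy t (by simpa using ht)).trans
        (by linarith))).1)).differentiableAt.differentiableWithinAt
    have h1 := hd.deriv_eq_smul_circleIntegral hρ0
    have h2 : deriv (fun t : ℂ => f (y + t • v)) 0 = fderiv ℂ f y v := by
      have := (hasDerivAt_comp_line (y := y) (w := v) (t := 0) (f := f) (hfa _ (hmem _
        ((hline y hy 0 (by simpa using hρ0.le)).trans (by linarith))).1)).deriv
      simpa using this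
    rw [h2] at h1
    rw [eq_inv_mul_iff_mul_eq₀ Complex.two_pi_I_ne_zero, ← smul_eq_mul, ← h1, circleIntegral]
    simp [hc, mul_assoc]
  have hcont : ∀ y ∈ ball x₀ r, Continuous fun θ : ℝ => c θ * f (y + circleMap 0 ρ θ • v) := by
    intro y hy
    refine hcc.mul (continuous_iff_continuousAt.2 fun θ => ?_)
    have h1 : ContinuousAt f (y + circleMap 0 ρ θ • v) := (hfa _ (hmem _ ((hline y hy _
      (hcirc θ).le).trans (by linarith))).1).continuousAt
    have h2 : Continuous fun θ : ℝ => y + circleMap 0 ρ θ • v :=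
      continuous_const.add ((continuous_circleMap 0 ρ).smul continuous_const)
    exact ContinuousAt.comp (f := fun θ : ℝ => y + circleMap 0 ρ θ • v) h1 h2.continuousAt
  have hx₀r : x₀ ∈ ball x₀ r := mem_ball_self hr0
  have hmeas : MeasureTheory.AEStronglyMeasurable
      (fun θ : ℝ => c θ • fderiv ℂ f (x₀ + circleMap 0 ρ θ • v))
      (MeasureTheory.volume.restrict (Set.uIoc 0 (2 * Real.pi))) := by
    borelize E
    borelize (E →L[ℂ] ℂ)
    have := FiniteDimensional.proper ℂ (E →L[ℂ] ℂ)
    have h2 : Continuous fun θ : ℝ => x₀ + circleMap 0 ρ θ • v :=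
      continuous_const.add ((continuous_circleMap 0 ρ).smul continuous_const)
    exact (hcc.measurable.smul
      ((measurable_fderiv ℂ f).comp h2.measurable)).aestronglyMeasurable
  have hint := intervalIntegral.hasFDerivAt_integral_of_dominated_of_fderiv_le (𝕜 := ℂ)
    (μ := MeasureTheory.volume) (a := 0) (b := 2 * Real.pi) (x₀ := x₀) (s := ball x₀ r)
    (F := fun y θ => c θ * f (y + circleMap 0 ρ θ • v))
    (F' := fun y θ => c θ • fderiv ℂ f (y + circleMap 0 ρ θ • v))
    (bound := fun _ => ρ⁻¹ * (M / r)) (ball_mem_nhds x₀ hr0)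
    (by filter_upwards [ball_mem_nhds x₀ hr0] with y hy using (hcont y hy).aestronglyMeasurable)
    ((hcont x₀ hx₀r).intervalIntegrable _ _) hmeas
    (Eventually.of_forall fun θ _ y hy => by
      rw [norm_smul, hcn]
      exact mul_le_mul_of_nonneg_left (hfd _ (hline y hy _ (hcirc θ).le)) (by positivity))
    intervalIntegrable_const
    (Eventually.of_forall fun θ _ y hy => by
      have h1 : HasFDerivAt f (fderiv ℂ f (y + circleMap 0 ρ θ • v)) (y + circleMap 0 ρ θ • v) :=
        (hfa _ (hmem _ ((hline y hy _ (hcirc θ).le).trans (by linarith))).1).hasFDerivAt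
      have h2 : HasFDerivAt (fun y : E => y + circleMap 0 ρ θ • v) (ContinuousLinearMap.id ℂ E) y :=
        (hasFDerivAt_id y).add_const _
      simpa using (h1.comp y h2).const_mul (c θ))
  refine ((hint.differentiableAt.const_mul (2 * Real.pi * Complex.I)⁻¹).congr_of_eventuallyEq ?_)
  filter_upwards [ball_mem_nhds x₀ hr0] with y hy using hformula y hy

/-- A holomorphic function of several variables is smooth. -/
lemma contDiffOn_of_differentiableOn [FiniteDimensional ℂ E] {U : Set E} (hU : IsOpen U) (k : ℕ)
    {f : E → ℂ} (hf : DifferentiableOn ℂ f U) : ContDiffOn ℂ k f U := by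
  induction k generalizing f with
  | zero => exact contDiffOn_zero.2 hf.continuousOn
  | succ k ih =>
    push_cast
    rw [contDiffOn_succ_iff_fderiv_of_isOpen hU]
    refine ⟨hf, fun h => absurd h (by simp), contDiffOn_clm_apply.2 fun v => ?_⟩
    exact ih (differentiableOn_fderiv_apply hU hf v)

end Smoothness

/-! ### Symmetry of iterated derivatives -/

section Symmetry

variable {E : Type*} [NormedAddCommGroup E] [NormedSpace ℂ E]

/-- The iterated directional derivative of `f` along a list of vectors. -/
noncomputable def dirDeriv (f : E → ℂ) : List E → E → ℂ
  | [] => f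
  | v :: l => fun x => fderiv ℂ (dirDeriv f l) x v

variable [FiniteDimensional ℂ E] {U : Set E} {f : E → ℂ}

lemma differentiableOn_dirDeriv (hU : IsOpen U) (hf : DifferentiableOn ℂ f U) (l : List E) :
    DifferentiableOn ℂ (dirDeriv f l) U := by
  induction l with
  | nil => exact hf
  | cons v l ih => exact differentiableOn_fderiv_apply hU ih v

/-- Iterated directional derivatives of a holomorphic function do not depend on their order. -/
lemma dirDeriv_perm (hU : IsOpen U) (hf : DifferentiableOn ℂ f U) {l l' : List E}
    (h : l.Perm l') : Set.EqOn (dirDeriv f l) (dirDeriv f l') U := by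
  induction h with
  | nil => exact fun _ _ => rfl
  | cons v _ ih =>
    intro x hx
    have : dirDeriv f _ =ᶠ[𝓝 x] dirDeriv f _ := ih.eventuallyEq_of_mem (hU.mem_nhds hx)
    simp only [dirDeriv, this.fderiv_eq]
  | swap v w l =>
    intro x hx
    have hd := contDiffOn_of_differentiableOn hU 2 (differentiableOn_dirDeriv hU hf l)
    have hx2 : ContDiffAt ℂ 2 (dirDeriv f l) x := hd.contDiffAt (hU.mem_nhds hx)
    have hs : IsSymmSndFDerivAt ℂ (dirDeriv f l) x :=
      hx2.isSymmSndFDerivAt (by simp)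
    have hdd : DifferentiableAt ℂ (fderiv ℂ (dirDeriv f l)) x :=
      (hx2.fderiv_right (m := 1) (by norm_num)).differentiableAt (by norm_num)
    simp only [dirDeriv]
    have h1 : ∀ u v : E, fderiv ℂ (fun y => fderiv ℂ (dirDeriv f l) y u) x v
        = fderiv ℂ (fderiv ℂ (dirDeriv f l)) x v u := by
      intro u v
      rw [fderiv_clm_apply hdd (differentiableAt_const u)]
      simp
    rw [h1, h1]
    exact hs _ _
  | trans _ _ ih1 ih2 => exact ih1.trans ih2

lemma iteratedFDeriv_eq_dirDeriv (hU : IsOpen U) (hf : DifferentiableOn ℂ f U) (m : ℕ)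
    {x : E} (hx : x ∈ U) (v : Fin m → E) :
    iteratedFDeriv ℂ m f x v = dirDeriv f (List.ofFn v) x := by
  induction m generalizing x with
  | zero => simp [dirDeriv]
  | succ m ih =>
    rw [List.ofFn_succ, dirDeriv, iteratedFDeriv_succ_apply_left]
    have hd : DifferentiableAt ℂ (iteratedFDeriv ℂ m f) x := by
      have h1 : ContDiffAt ℂ (m + 1 : ℕ) f x :=
        (contDiffOn_of_differentiableOn hU (m + 1) hf).contDiffAt (hU.mem_nhds hx)
      exact h1.differentiableAt_iteratedFDeriv (by exact_mod_cast Nat.lt_succ_self m)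
    have h2 : (fun y => iteratedFDeriv ℂ m f y (Fin.tail v))
        =ᶠ[𝓝 x] dirDeriv f (List.ofFn (Fin.tail v)) := by
      filter_upwards [hU.mem_nhds hx] with y hy using ih hy _
    show _ = fderiv ℂ (dirDeriv f (List.ofFn (Fin.tail v))) x (v 0)
    rw [← h2.fderiv_eq]
    have h4 := (ContinuousMultilinearMap.apply ℂ (fun _ : Fin m => E) ℂ
      (Fin.tail v)).hasFDerivAt.comp x hd.hasFDerivAt
    have h5 := h4.fderiv
    simp only [Function.comp_def, ContinuousMultilinearMap.apply_apply] at h5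
    rw [h5]
    rfl

end Symmetry

/-! ### Taylor coefficients of bounded functions on the disc -/

section Caratheodory

open Complex Real

/-- Averages over the unit circle against a trigonometric polynomial with frequencies `0` and `± m`:
only the Taylor coefficients of order `0` and `m` contribute. -/
lemma circleAverage_fejer {g : ℂ → ℂ} (hg : DifferentiableOn ℂ g (closedBall 0 1)) {m : ℕ}
    (hm : 1 ≤ m) (p q : ℂ) :
    circleAverage (fun z => (1 + p * (z ^ m)⁻¹ + q * z ^ m) * g z) 0 1
      = g 0 + p * (iteratedDeriv m g 0 / m.factorial) := by
  have hcs : ContinuousOn g (sphere 0 1) := hg.continuousOn.mono sphere_subset_closedBall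
  have hne : ∀ z ∈ sphere (0 : ℂ) 1, z ^ m ≠ 0 := fun z hz => by
    rw [← norm_ne_zero_iff, norm_pow, mem_sphere_zero_iff_norm.1 hz]; simp
  have hz : ContinuousOn (fun z : ℂ => z ^ m) (sphere 0 1) := (continuous_pow m).continuousOn
  have i1 : CircleIntegrable g 0 1 := hcs.circleIntegrable zero_le_one
  have i2 : CircleIntegrable (fun z => p • ((z ^ m)⁻¹ * g z)) 0 1 :=
    (((hz.inv₀ hne).mul hcs).const_smul p).circleIntegrable zero_le_one
  have i3 : CircleIntegrable (fun z => q • (z ^ m * g z)) 0 1 :=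
    ((hz.mul hcs).const_smul q).circleIntegrable zero_le_one
  have e1 : circleAverage g 0 1 = g 0 := by
    refine DiffContOnCl.circleAverage ?_
    rw [abs_one]
    exact (hg.mono closure_ball_subset_closedBall).diffContOnCl
  have e3 : circleAverage (fun z => z ^ m * g z) 0 1 = 0 := by
    have h : DifferentiableOn ℂ (fun z => z ^ m * g z) (closedBall 0 1) :=
      (differentiable_pow m).differentiableOn.mul hg
    rw [DiffContOnCl.circleAverage (by
      rw [abs_one]; exact (h.mono closure_ball_subset_closedBall).diffContOnCl)]
    simp [Nat.one_le_iff_ne_zero.1 hm]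
  have e2 : circleAverage (fun z => (z ^ m)⁻¹ * g z) 0 1 = iteratedDeriv m g 0 / m.factorial := by
    rw [circleAverage_eq_circleIntegral one_ne_zero]
    have h := hg.circleIntegral_one_div_sub_center_pow_smul one_pos m
    have h' : ∮ z in C(0, 1), (z - 0)⁻¹ • ((z ^ m)⁻¹ * g z)
        = ∮ z in C(0, 1), (1 / (z - 0) ^ (m + 1)) • g z := by
      congr 1
      ext z
      simp only [sub_zero, smul_eq_mul, one_div, pow_succ, mul_inv]
      ring
    rw [h', h, smul_smul]
    have := Complex.two_pi_I_ne_zero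
    simp only [smul_eq_mul]
    field_simp
  have hsplit : (fun z => (1 + p * (z ^ m)⁻¹ + q * z ^ m) * g z)
      = (g + fun z => p • ((z ^ m)⁻¹ * g z)) + fun z => q • (z ^ m * g z) := by
    ext z
    simp only [Pi.add_apply, smul_eq_mul]
    ring
  rw [hsplit, circleAverage_add (i1.add i2) i3, circleAverage_add i1 i2]
  have s2 := circleAverage_fun_smul (a := p) (f := fun z => (z ^ m)⁻¹ * g z) (c := 0) (R := 1)
  have s3 := circleAverage_fun_smul (a := q) (f := fun z => z ^ m * g z) (c := 0) (R := 1)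
  rw [s2, s3, e1, e2, e3]
  simp

/-- If `g = ∑ cₘ zᵐ` is bounded by `M` on the unit disc, then `|cₘ| ≤ 2 (M - |c₀|)` for `m ≥ 1`.
The combination `|c₀| + |cₘ| / 2` is the average of `g` against the nonnegative kernel
`1 + Re (η z⁻ᵐ)`, which has average `1`. -/
lemma norm_taylorCoeff_le {g : ℂ → ℂ} (hg : DifferentiableOn ℂ g (closedBall 0 1)) {M : ℝ}
    (hM : ∀ z ∈ sphere (0 : ℂ) 1, ‖g z‖ ≤ M) {m : ℕ} (hm : 1 ≤ m) :
    ‖iteratedDeriv m g 0 / m.factorial‖ ≤ 2 * (M - ‖g 0‖) := by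
  set c := iteratedDeriv m g 0 / m.factorial with hc
  obtain ⟨ε, hε, hε'⟩ := exists_phase (g 0)
  obtain ⟨η, hη, hη'⟩ := exists_phase (ε * c)
  set K : ℂ → ℂ := fun z => 1 + (η / 2) * (z ^ m)⁻¹ + ((starRingEnd ℂ) η / 2) * z ^ m with hK
  have hKn : ∀ z ∈ sphere (0 : ℂ) 1, ((‖K z‖ : ℝ) : ℂ) = K z := by
    intro z hz
    have hz1 : ‖z ^ m‖ = 1 := by rw [norm_pow, mem_sphere_zero_iff_norm.1 hz, one_pow]
    have h1 : K z = ((1 + (η * (z ^ m)⁻¹).re : ℝ) : ℂ) := by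
      have h2 : (z ^ m)⁻¹ = (starRingEnd ℂ) (z ^ m) := Complex.inv_eq_conj hz1
      have h3 := Complex.re_eq_add_conj (η * (z ^ m)⁻¹)
      rw [Complex.ofReal_add, h3, Complex.ofReal_one, map_mul, h2, Complex.conj_conj, hK]
      simp only [h2]
      ring
    have h4 : 0 ≤ 1 + (η * (z ^ m)⁻¹).re := by
      have := (abs_le.1 (Complex.abs_re_le_norm (η * (z ^ m)⁻¹))).1
      rw [norm_mul, hη, norm_inv, hz1] at this
      linarith
    rw [h1, Complex.norm_real, Real.norm_of_nonneg h4]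
  have hcm : ∀ θ, circleMap 0 1 θ ∈ sphere (0 : ℂ) 1 := fun θ =>
    circleMap_mem_sphere 0 zero_le_one θ
  have hKc : ContinuousOn K (sphere 0 1) := by
    have hne : ∀ z ∈ sphere (0 : ℂ) 1, z ^ m ≠ 0 := fun z hz => by
      rw [← norm_ne_zero_iff, norm_pow, mem_sphere_zero_iff_norm.1 hz]; simp
    have hz : ContinuousOn (fun z : ℂ => z ^ m) (sphere 0 1) := (continuous_pow m).continuousOn
    exact (continuousOn_const.add (continuousOn_const.mul (hz.inv₀ hne))).add
      (continuousOn_const.mul hz)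
  have hKcm : Continuous fun θ => K (circleMap 0 1 θ) :=
    hKc.comp_continuous (continuous_circleMap 0 1) hcm
  have hgcm : Continuous fun θ => g (circleMap 0 1 θ) :=
    (hg.continuousOn.mono sphere_subset_closedBall).comp_continuous (continuous_circleMap 0 1) hcm
  have hKint : ∫ θ in (0 : ℝ)..2 * π, ‖K (circleMap 0 1 θ)‖ = 2 * π := by
    have h1 := circleAverage_fejer (g := fun _ => 1) (differentiableOn_const 1) hm (η / 2)
      ((starRingEnd ℂ) η / 2)
    have h2 : iteratedDeriv m (fun _ : ℂ => (1 : ℂ)) 0 = 0 := by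
      rw [iteratedDeriv_const]; simp [Nat.one_le_iff_ne_zero.1 hm]
    simp only [mul_one, h2, zero_div, mul_zero, add_zero] at h1
    rw [circleAverage_def] at h1
    have h3 : ∫ θ in (0 : ℝ)..2 * π, K (circleMap 0 1 θ)
        = ((∫ θ in (0 : ℝ)..2 * π, ‖K (circleMap 0 1 θ)‖ : ℝ) : ℂ) := by
      rw [← intervalIntegral.integral_ofReal]
      exact intervalIntegral.integral_congr fun θ _ => (hKn _ (hcm θ)).symm
    rw [show (∫ θ in (0 : ℝ)..2 * π, 1 + η / 2 * (circleMap 0 1 θ ^ m)⁻¹ +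
      (starRingEnd ℂ) η / 2 * circleMap 0 1 θ ^ m) = _ from h3, real_smul, ← ofReal_mul] at h1
    have h4 : (2 * π)⁻¹ * ∫ θ in (0 : ℝ)..2 * π, ‖K (circleMap 0 1 θ)‖ = 1 := by exact_mod_cast h1
    have := Real.two_pi_pos
    field_simp at h4
    linarith
  have hmain := circleAverage_fejer hg hm (η / 2) ((starRingEnd ℂ) η / 2)
  have hle : ‖circleAverage (fun z => K z * g z) 0 1‖ ≤ M := by
    rw [circleAverage_def, norm_smul, norm_inv, Real.norm_of_nonneg Real.two_pi_pos.le,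
      inv_mul_le_iff₀ Real.two_pi_pos]
    calc _ ≤ ∫ θ in (0 : ℝ)..2 * π, ‖K (circleMap 0 1 θ) * g (circleMap 0 1 θ)‖ :=
          intervalIntegral.norm_integral_le_integral_norm Real.two_pi_pos.le
      _ ≤ ∫ θ in (0 : ℝ)..2 * π, ‖K (circleMap 0 1 θ)‖ * M := by
          refine intervalIntegral.integral_mono_on Real.two_pi_pos.le
            ((hKcm.mul hgcm).norm.intervalIntegrable _ _)
            ((hKcm.norm.mul continuous_const).intervalIntegrable _ _) fun θ _ => ?_
          rw [norm_mul]
          exact mul_le_mul_of_nonneg_left (hM _ (hcm θ)) (norm_nonneg _)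
      _ = 2 * π * M := by rw [intervalIntegral.integral_mul_const, hKint]
  rw [show circleAverage (fun z => K z * g z) 0 1 = _ from hmain] at hle
  have hfin : ‖g 0‖ + ‖c‖ / 2 ≤ M := by
    have h1 : (g 0 + η / 2 * c) * ε = ((‖g 0‖ + ‖c‖ / 2 : ℝ) : ℂ) := by
      have h2 : ‖ε * c‖ = ‖c‖ := by rw [norm_mul, hε, one_mul]
      rw [h2] at hη'
      rw [add_mul, hε']
      push_cast
      rw [← hη']
      ring
    have h3 := congrArg norm h1
    rw [norm_mul, hε, mul_one, Complex.norm_real, Real.norm_of_nonneg (by positivity)] at h3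
    rwa [← h3]
  linarith

end Caratheodory

/-! ### The homogeneous expansion -/

section Expansion

variable {n : ℕ}

/-- The multi-index `α` of the monomial `z_j`: `αᵢ` is the number of times that `i` occurs
in `j`. -/
def countIndex (j : List (Fin n)) : Fin n → ℕ := fun i => j.count i

lemma countIndex_append (j k : List (Fin n)) :
    countIndex (j ++ k) = countIndex j + countIndex k := by
  ext i; simp [countIndex]

lemma countIndex_singleton (k : Fin n) : countIndex [k] = Pi.single k 1 := by
  ext i
  rw [countIndex, List.count_singleton, Pi.single_apply]
  rcases eq_or_ne i k with rfl | h
  · simp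
  · simp [h, h.symm]

lemma countIndex_cons (k : Fin n) (j : List (Fin n)) :
    countIndex (k :: j) = countIndex j + Pi.single k 1 := by
  rw [← List.singleton_append, countIndex_append, countIndex_singleton, add_comm]

lemma sum_countIndex (j : List (Fin n)) : ∑ i, countIndex j i = j.length := by
  induction j with
  | nil => simp [countIndex]
  | cons k j ih => simp [countIndex_cons, sum_add_distrib, ih]

lemma countIndex_mem (j : List (Fin n)) : countIndex j ∈ piAntidiag univ j.length := by
  simp [mem_piAntidiag, sum_countIndex]

lemma monomialValue_eq (j : List (Fin n)) (u : Fin n → ℂ) :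
    monomialValue j u = monom (countIndex j) u := by
  induction j with
  | nil => simp [monomialValue, countIndex, monom]
  | cons k j ih =>
    rw [countIndex_cons, monom_add, monom_single, ← ih]
    simp [monomialValue, mul_comm]

/-- There are `m! / α!` words of length `m` in which the letter `i` occurs `αᵢ` times. -/
lemma sum_words (m : ℕ) (G : (Fin n → ℕ) → ℂ) :
    ∑ q : Fin m → Fin n, G (countIndex (List.ofFn q))
      = ∑ α ∈ piAntidiag univ m, (m.factorial : ℂ) / ((∏ i, (α i).factorial : ℕ) : ℂ) * G α := by
  induction m generalizing G with
  | zero =>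
    simp only [piAntidiag_zero, sum_singleton]
    simp
    rfl
  | succ m ih =>
    rw [← (Fin.consEquiv fun _ => Fin n).sum_comp, Fintype.sum_prod_type]
    have hcons : ∀ (k : Fin n) (q : Fin m → Fin n),
        List.ofFn ((Fin.consEquiv fun _ => Fin n) (k, q)) = k :: List.ofFn q := fun k q => by
      simp [Fin.consEquiv]
    simp_rw [hcons, countIndex_cons]
    have h1 : ∀ k : Fin n, ∑ q : Fin m → Fin n, G (countIndex (List.ofFn q) + Pi.single k 1)
        = ∑ α ∈ piAntidiag univ (m + 1),
          (α k : ℂ) * ((m.factorial : ℂ) / ((∏ i, (α i).factorial : ℕ) : ℂ) * G α) := by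
      intro k
      refine (ih fun α => G (α + Pi.single k 1)).trans ?_
      rw [sum_piAntidiag_succ m k _ fun α hα => by simp [hα]]
      refine sum_congr rfl fun β _ => ?_
      have h2 : ∏ i, ((β + Pi.single k 1 : Fin n → ℕ) i).factorial
          = (β k + 1) * ∏ i, (β i).factorial := by
        rw [← mul_prod_erase univ _ (mem_univ k), ← mul_prod_erase univ _ (mem_univ k)]
        simp only [Pi.add_apply, Pi.single_eq_same, Nat.factorial_succ, mul_assoc]
        congr 2
        refine prod_congr rfl fun i hi => ?_
        simp [(mem_erase.1 hi).1]
      have h3 : ((β k : ℂ) + 1) ≠ 0 := by exact_mod_cast Nat.succ_ne_zero (β k)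
      have h4 : ((∏ i, (β i).factorial : ℕ) : ℂ) ≠ 0 := by
        exact_mod_cast (prod_pos fun i _ => Nat.factorial_pos (β i)).ne'
      rw [h2]
      simp only [Pi.add_apply, Pi.single_eq_same]
      rw [Nat.cast_mul]
      push_cast at h4 ⊢
      field_simp
    simp_rw [h1]
    rw [sum_comm]
    refine sum_congr rfl fun α hα => ?_
    rw [← sum_mul]
    have h5 : ∑ k, (α k : ℂ) = (m + 1 : ℕ) := by
      rw [← (mem_piAntidiag.1 hα).1]; push_cast; rfl
    rw [h5, Nat.factorial_succ]
    push_cast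
    ring

/-- The homogeneous expansion of a bounded holomorphic function on a balanced domain: its
coefficients are the `c_j(f)`, and its homogeneous parts obey the one-variable coefficient
estimate on every complex line through the origin. -/
lemma exists_homogeneous_expansion {R : Set (Fin n → ℂ)} (hR : IsOpen R) (h0 : 0 ∈ R)
    (hbal : ∀ z ∈ R, ∀ t : ℂ, ‖t‖ ≤ 1 → t • z ∈ R) {f : (Fin n → ℂ) → ℂ}
    (hf : DifferentiableOn ℂ f R) {M : ℝ} (hM : ∀ z ∈ R, ‖f z‖ ≤ M) :
    ∃ a : (Fin n → ℕ) → ℂ, (∀ j : List (Fin n), monomialCoeff f j = a (countIndex j)) ∧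
      ∀ m, 1 ≤ m → ∀ z ∈ R, ‖homPoly m a z‖ ≤ 2 * (M - ‖f 0‖) := by
  set e : Fin n → Fin n → ℂ := fun i => Pi.single i 1 with he
  have hcoeff : ∀ j : List (Fin n), monomialCoeff f j
      = dirDeriv f (j.map e) 0 / ((∏ i : Fin n, (countIndex j i).factorial : ℕ) : ℂ) := by
    intro j
    rw [monomialCoeff, iteratedFDeriv_eq_dirDeriv hR hf _ h0]
    congr 2
    conv_rhs => rw [← List.ofFn_get j, List.map_ofFn]
    rfl
  have hperm : ∀ j j' : List (Fin n), countIndex j = countIndex j' →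
      monomialCoeff f j = monomialCoeff f j' := by
    intro j j' h
    have hp : j.Perm j' := List.perm_iff_count.2 fun i => congrFun h i
    rw [hcoeff, hcoeff, h, dirDeriv_perm hR hf (hp.map e) h0]
  -- `monomialCoeff f j` only depends on `countIndex j`, so any list with multi-index `α`
  -- defines `a α`
  refine ⟨fun α => monomialCoeff f (Function.invFun countIndex α), fun j => ?_, ?_⟩
  · exact hperm _ _ (Function.invFun_eq ⟨j, rfl⟩).symm
  set a : (Fin n → ℕ) → ℂ := fun α => monomialCoeff f (Function.invFun countIndex α) with ha
  have haj : ∀ j, monomialCoeff f j = a (countIndex j) := fun j =>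
    hperm _ _ (Function.invFun_eq ⟨j, rfl⟩).symm
  have hexp : ∀ (m : ℕ) (z : Fin n → ℂ),
      iteratedFDeriv ℂ m f 0 (fun _ => z) = m.factorial * homPoly m a z := by
    intro m z
    have hz : z = ∑ i, z i • e i := by
      ext k
      simp [he, Finset.sum_apply, Pi.single_apply]
    have h1 : iteratedFDeriv ℂ m f 0 (fun _ => z)
        = ∑ q : Fin m → Fin n, iteratedFDeriv ℂ m f 0 (fun i => z (q i) • e (q i)) := by
      conv_lhs => rw [hz]
      exact (iteratedFDeriv ℂ m f 0).map_sum (fun _ i => z i • e i)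
    have h2 : ∀ q : Fin m → Fin n, iteratedFDeriv ℂ m f 0 (fun i => z (q i) • e (q i))
        = (fun α => ((∏ i, (α i).factorial : ℕ) : ℂ) * (a α * monom α z))
          (countIndex (List.ofFn q)) := by
      intro q
      have h3 : (fun i => z (q i) • e (q i)) = fun i => (z ∘ q) i • (e ∘ q) i := rfl
      rw [h3, ContinuousMultilinearMap.map_smul_univ, iteratedFDeriv_eq_dirDeriv hR hf _ h0,
        ← List.map_ofFn]
      have h4 := hcoeff (List.ofFn q)
      have h5 : ((∏ i : Fin n, (countIndex (List.ofFn q) i).factorial : ℕ) : ℂ) ≠ 0 := by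
        exact_mod_cast (prod_pos fun i _ => Nat.factorial_pos _).ne'
      rw [eq_div_iff h5, haj] at h4
      rw [← h4, smul_eq_mul]
      simp only [← monomialValue_eq, monomialValue, List.map_ofFn, List.prod_ofFn]
      ring
    rw [h1, sum_congr rfl fun q _ => h2 q,
      sum_words m fun α => ((∏ i, (α i).factorial : ℕ) : ℂ) * (a α * monom α z), homPoly, mul_sum]
    refine sum_congr rfl fun α _ => ?_
    have h5 : ((∏ i : Fin n, (α i).factorial : ℕ) : ℂ) ≠ 0 := by
      exact_mod_cast (prod_pos fun i _ => Nat.factorial_pos _).ne'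
    field_simp
  intro m hm z hz
  set L : ℂ →L[ℂ] (Fin n → ℂ) := (ContinuousLinearMap.id ℂ ℂ).smulRight z with hL
  have hLt : ∀ t, L t = t • z := fun t => by simp [hL]
  set V : Set ℂ := L ⁻¹' R with hV
  have hVo : IsOpen V := hR.preimage L.continuous
  have hV0 : (0 : ℂ) ∈ V := by simpa [hV] using h0
  have hVd : DifferentiableOn ℂ (f ∘ L) V :=
    hf.comp L.differentiable.differentiableOn fun t ht => ht
  have hball : closedBall (0 : ℂ) 1 ⊆ V := fun t ht => by
    rw [hV, Set.mem_preimage, hLt]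
    exact hbal z hz t (by simpa using ht)
  have hiter : iteratedDeriv m (f ∘ L) 0 = m.factorial * homPoly m a z := by
    rw [← hexp, iteratedDeriv_eq_iteratedFDeriv]
    have h := L.iteratedFDerivWithin_comp_right (contDiffOn_of_differentiableOn hR m hf)
      hR.uniqueDiffOn hVo.uniqueDiffOn (x := 0) (by simpa using h0) le_rfl
    rw [iteratedFDerivWithin_of_isOpen m hVo hV0,
      iteratedFDerivWithin_of_isOpen m hR (by simpa using h0)] at h
    rw [h]
    simp [hLt]
  have hmain := norm_taylorCoeff_le (hVd.mono hball) (M := M)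
    (fun t ht => hM _ (hball (sphere_subset_closedBall ht))) hm
  rw [hiter] at hmain
  have hfac : (m.factorial : ℂ) ≠ 0 := by exact_mod_cast (Nat.factorial_pos m).ne'
  rw [mul_div_cancel_left₀ _ hfac] at hmain
  simpa using hmain

end Expansion

end

section

open Finset

/-! ### The unit ball of `ℓ_r` -/

section Ball

variable {n : ℕ} {r : ℝ≥0∞}

lemma isOpen_lpBall (hr : 1 ≤ r) (n : ℕ) : IsOpen (lpBall r n) := by
  have : Fact (1 ≤ r) := ⟨hr⟩
  exact isOpen_lt (PiLp.continuous_toLp r fun _ : Fin n => ℂ).norm continuous_const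

lemma zero_mem_lpBall (hr : 1 ≤ r) (n : ℕ) : (0 : Fin n → ℂ) ∈ lpBall r n := by
  have : Fact (1 ≤ r) := ⟨hr⟩
  show ‖(WithLp.toLp r 0 : PiLp r fun _ : Fin n => ℂ)‖ < 1
  simp

lemma mem_lpBall_iff (hr : 1 ≤ r) (hr' : r ≠ ∞) (z : Fin n → ℂ) :
    z ∈ lpBall r n ↔ ∑ i, ‖z i‖ ^ r.toReal < 1 := by
  have h0 : 0 < r.toReal := ENNReal.toReal_pos (by rintro rfl; simp at hr) hr'
  show ‖(WithLp.toLp r z : PiLp r fun _ : Fin n => ℂ)‖ < 1 ↔ _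
  rw [PiLp.norm_eq_sum h0]
  have hs : 0 ≤ ∑ i, ‖z i‖ ^ r.toReal := sum_nonneg fun _ _ => by positivity
  constructor
  · intro h
    by_contra! h1
    exact absurd h (not_lt.2 (Real.one_le_rpow h1 (by positivity)))
  · intro h
    exact Real.rpow_lt_one hs h (by positivity)

lemma mul_mem_lpBall (hr : 1 ≤ r) {v z : Fin n → ℂ} (hv : v ∈ lpBall r n)
    (hz : ∀ i, ‖z i‖ ≤ 1) : v * z ∈ lpBall r n := by
  have hle : ∀ i, ‖(v * z) i‖ ≤ ‖v i‖ := fun i => by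
    rw [Pi.mul_apply, norm_mul]
    exact mul_le_of_le_one_right (norm_nonneg _) (hz i)
  rcases eq_or_ne r ∞ with rfl | hr'
  · have hv' : ‖(WithLp.toLp ∞ v : PiLp ∞ fun _ : Fin n => ℂ)‖ < 1 := hv
    show ‖(WithLp.toLp ∞ (v * z) : PiLp ∞ fun _ : Fin n => ℂ)‖ < 1
    rw [PiLp.norm_eq_ciSup] at hv' ⊢
    exact (ciSup_mono (Set.finite_range _).bddAbove hle).trans_lt hv'
  · rw [mem_lpBall_iff hr hr'] at hv ⊢
    refine (sum_le_sum fun i _ => ?_).trans_lt hv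
    exact Real.rpow_le_rpow (norm_nonneg _) (hle i) ENNReal.toReal_nonneg

lemma smul_mem_lpBall (hr : 1 ≤ r) {v : Fin n → ℂ} (hv : v ∈ lpBall r n) {t : ℂ}
    (ht : ‖t‖ ≤ 1) : t • v ∈ lpBall r n := by
  have : t • v = v * fun _ => t := by
    ext i; simp [mul_comm]
  rw [this]
  exact mul_mem_lpBall hr hv fun _ => ht

lemma sigma_of_two_le (h : 2 ≤ r) : sigma r = 1 / 2 := by
  rw [sigma, min_eq_right h]; norm_num

lemma sigma_of_le_two (h : r ≤ 2) : sigma r = 1 - 1 / r.toReal := by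
  rw [sigma, min_eq_left h]

lemma one_le_toReal (hr : 1 ≤ r) (hr' : r ≠ ∞) : 1 ≤ r.toReal := by
  simpa using ENNReal.toReal_mono hr' hr

lemma sigma_nonneg (hr : 1 ≤ r) : 0 ≤ sigma r := by
  rcases le_total 2 r with h | h
  · rw [sigma_of_two_le h]; norm_num
  · rw [sigma_of_le_two h, sub_nonneg]
    have := one_le_toReal hr (ne_top_of_le_ne_top (by simp) h)
    exact (div_le_one (by linarith)).2 this

lemma sigma_le_one (r : ℝ≥0∞) : sigma r ≤ 1 := by
  rw [sigma]
  have : 0 ≤ 1 / (min r 2).toReal := by positivity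
  linarith

/-- A bound for a homogeneous polynomial on the open unit ball holds on the closed ball. -/
lemma norm_homPoly_le_of_lpBall (hr : 1 ≤ r) (hr' : r ≠ ∞) {m : ℕ} {a : (Fin n → ℕ) → ℂ} {B : ℝ}
    (hB : ∀ z ∈ lpBall r n, ‖homPoly m a z‖ ≤ B) {z : Fin n → ℂ}
    (hz : ∑ i, ‖z i‖ ^ r.toReal ≤ 1) : ‖homPoly m a z‖ ≤ B := by
  have h0 : 0 < r.toReal := zero_lt_one.trans_le (one_le_toReal hr hr')
  have h1 : ∀ t ∈ Set.Ioo (0 : ℝ) 1, t ^ m * ‖homPoly m a z‖ ≤ B := by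
    intro t ht
    have h2 : ((t : ℂ) • z) ∈ lpBall r n := by
      rw [mem_lpBall_iff hr hr']
      have h3 : ∀ i, ‖((t : ℂ) • z) i‖ ^ r.toReal = t ^ r.toReal * ‖z i‖ ^ r.toReal := by
        intro i
        rw [Pi.smul_apply, norm_smul, Complex.norm_real, Real.norm_of_nonneg ht.1.le,
          Real.mul_rpow ht.1.le (norm_nonneg _)]
      simp_rw [h3, ← mul_sum]
      calc _ ≤ t ^ r.toReal * 1 := mul_le_mul_of_nonneg_left hz (Real.rpow_nonneg ht.1.le _)
        _ < 1 := by rw [mul_one]; exact Real.rpow_lt_one ht.1.le ht.2 h0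
    have h4 := hB _ h2
    rwa [homPoly_smul, norm_mul, norm_pow, Complex.norm_real, Real.norm_of_nonneg ht.1.le] at h4
  have h5 : Filter.Tendsto (fun t : ℝ => t ^ m * ‖homPoly m a z‖) (nhdsWithin 1 (Set.Iio 1))
      (nhds (1 ^ m * ‖homPoly m a z‖)) :=
    (((continuous_pow m).mul continuous_const).tendsto 1).mono_left nhdsWithin_le_nhds
  rw [one_pow, one_mul] at h5
  refine le_of_tendsto h5 ?_
  filter_upwards [Ioo_mem_nhdsLT (zero_lt_one' ℝ)] with t ht using h1 t ht

/-- The coefficient estimate for homogeneous polynomials of degree `m + 1` on the ball of `ℓ_r`,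
for the monomials of the form `z ^ (α + e_k)` with `α ∈ T`. For `r ≥ 2` it is reduced to the
polydisc by the substitution `z ↦ v * z`. -/
lemma sum_coeff_le (hr : 1 ≤ r) (m : ℕ) (a : (Fin n → ℕ) → ℂ) {B : ℝ}
    (hB : ∀ z ∈ lpBall r n, ‖homPoly (m + 1) a z‖ ≤ B) {v : Fin n → ℂ} (hv : v ∈ lpBall r n)
    {T : Finset (Fin n → ℕ)} (hT : T ⊆ piAntidiag univ m) :
    ∑ α ∈ T, ∑ k, ‖a (α + Pi.single k 1) * monom (α + Pi.single k 1) v‖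
      ≤ 6 ^ (m + 1) * (#T : ℝ) ^ sigma r * B := by
  have hB0 : 0 ≤ B := (norm_nonneg _).trans (hB v hv)
  rcases le_total 2 r with h | h
  · have h1 := sum_coeff_le_of_polydisc m (fun α => a α * monom α v) (B := B)
      (fun z hz => by rw [← homPoly_mul_left]; exact hB _ (mul_mem_lpBall hr hv hz)) hT
    rw [sigma_of_two_le h, ← Real.sqrt_eq_rpow]
    refine h1.trans ?_
    gcongr
    calc (2 : ℝ) ^ m * 2 ^ (m + 1) = 2 * 4 ^ m := by
          rw [show (4 : ℝ) = 2 * 2 by norm_num, mul_pow]; ring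
      _ ≤ 6 * 6 ^ m := by gcongr <;> norm_num
      _ = _ := by ring
  · have hr' : r ≠ ∞ := ne_top_of_le_ne_top (by simp) h
    have h1 := sum_coeff_le_of_lpBall (one_le_toReal hr hr') m a
      (fun z hz => norm_homPoly_le_of_lpBall hr hr' hB hz)
      ((mem_lpBall_iff hr hr' v).1 hv).le hT
    rw [sigma_of_le_two h]
    refine h1.trans ?_
    gcongr
    have h3 : Real.exp m ≤ 3 ^ m := by
      rw [← Real.exp_one_pow]
      gcongr
      exact Real.exp_one_lt_three.le
    calc (2 : ℝ) ^ (m + 1) * Real.exp m ≤ 2 ^ (m + 1) * 3 ^ m := by gcongr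
      _ = 2 * 6 ^ m := by rw [show (6 : ℝ) = 2 * 3 by norm_num, mul_pow]; ring
      _ ≤ 6 * 6 ^ m := by gcongr; norm_num
      _ = _ := by ring

end Ball

/-! ### Index sets -/

section Indices

/-- The multi-index of a tuple with entries in `{1, …, n}`. -/
def exponentOf (n : ℕ) (l : List ℕ) : Fin n → ℕ := fun i => l.count ((i : ℕ) + 1)

/-- In `indicesIn` the coercion `Fin n → ℕ` is applied to the list before `1` is added to the
entries; both steps are combined here. -/
lemma mem_indicesIn {J : Set (List ℕ)} {n : ℕ} {j : List (Fin n)} :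
    j ∈ indicesIn J n ↔ j.map (fun i : Fin n => (i : ℕ) + 1) ∈ J := by
  have : j.map (fun i : Fin n => (i : ℕ) + 1)
      = (do let a ← j; pure (a : ℕ)).map fun i => i + 1 := by
    induction j with
    | nil => rfl
    | cons k j ih => simpa using ih
  rw [this]
  rfl

lemma exponentOf_map {n : ℕ} (j : List (Fin n)) :
    exponentOf n (j.map fun i : Fin n => (i : ℕ) + 1) = countIndex j := by
  have hinj : Function.Injective fun i : Fin n => (i : ℕ) + 1 := fun i k h =>
    Fin.ext (Nat.succ_injective h)
  ext i
  exact List.count_map_of_injective j _ hinj i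

lemma exists_map_eq {n : ℕ} {l : List ℕ} (h1 : ∀ k ∈ l, 1 ≤ k) (h2 : ∀ k ∈ l, k ≤ n) :
    ∃ j : List (Fin n), j.map (fun i : Fin n => (i : ℕ) + 1) = l := by
  induction l with
  | nil => exact ⟨[], rfl⟩
  | cons k l ih =>
    simp only [List.mem_cons, forall_eq_or_imp] at h1 h2
    obtain ⟨j, rfl⟩ := ih h1.2 h2.2
    refine ⟨⟨k - 1, by omega⟩ :: j, ?_⟩
    have := h1.1
    simp only [List.map_cons]
    congr 1
    omega

lemma countIndex_injOn {n : ℕ} {J : Set (List ℕ)} (hJ : J ⊆ allIndices) :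
    Set.InjOn countIndex (indicesIn J n) := by
  have hinj : Function.Injective fun i : Fin n => (i : ℕ) + 1 := fun i k h =>
    Fin.ext (Nat.succ_injective h)
  intro j hj j' hj' h
  have hp : j.Perm j' := List.perm_iff_count.2 fun i => congrFun h i
  rw [mem_indicesIn] at hj hj'
  have := (hp.map fun i : Fin n => (i : ℕ) + 1).eq_of_pairwise (le := (· ≤ ·))
    (fun _ _ _ _ => le_antisymm) (hJ hj).1 (hJ hj').1
  exact List.map_injective_iff.2 hinj this

lemma exists_of_mem_reducedSet {J : Set (List ℕ)} {m n : ℕ} {l : List ℕ}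
    (hl : l ∈ reducedSet (homogeneousPart J (m + 1) n)) :
    ∃ j : List (Fin n), j.length = m ∧ j.map (fun i : Fin n => (i : ℕ) + 1) = l := by
  obtain ⟨⟨_, h1⟩, k, _, _, hlen, hle⟩ := hl
  obtain ⟨j, rfl⟩ := exists_map_eq h1 fun k hk => hle k (List.mem_append_left _ hk)
  exact ⟨j, by simpa using hlen, rfl⟩

lemma exponentOf_mapsTo (J : Set (List ℕ)) (m n : ℕ) :
    Set.MapsTo (exponentOf n) (reducedSet (homogeneousPart J (m + 1) n))
      (piAntidiag (univ : Finset (Fin n)) m : Finset (Fin n → ℕ)) := by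
  intro l hl
  obtain ⟨j, rfl, rfl⟩ := exists_of_mem_reducedSet hl
  rw [exponentOf_map]
  exact countIndex_mem j

lemma exponentOf_injOn (J : Set (List ℕ)) (m n : ℕ) :
    Set.InjOn (exponentOf n) (reducedSet (homogeneousPart J (m + 1) n)) := by
  intro l hl l' hl' h
  obtain ⟨j, _, rfl⟩ := exists_of_mem_reducedSet hl
  obtain ⟨j', _, rfl⟩ := exists_of_mem_reducedSet hl'
  rw [exponentOf_map, exponentOf_map] at h
  rw [countIndex_injOn (n := n) subset_rfl (mem_indicesIn.2 hl.1)
    (mem_indicesIn.2 hl'.1) h]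

lemma finite_reducedSet (J : Set (List ℕ)) (m n : ℕ) :
    (reducedSet (homogeneousPart J (m + 1) n)).Finite :=
  Set.Finite.of_injOn (exponentOf_mapsTo J m n) (exponentOf_injOn J m n) (finite_toSet _)

lemma ncard_reducedSet_le (J : Set (List ℕ)) (m n : ℕ) :
    (reducedSet (homogeneousPart J (m + 1) n)).ncard
      ≤ #(piAntidiag (univ : Finset (Fin n)) m) := by
  rw [← Set.ncard_coe_finset]
  exact Set.ncard_le_ncard_of_injOn _ (exponentOf_mapsTo J m n) (exponentOf_injOn J m n)
    (finite_toSet _)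

/-- The multi-indices of the elements of `J(m + 1, n)*`. -/
noncomputable def reducedExponents (J : Set (List ℕ)) (m n : ℕ) : Finset (Fin n → ℕ) :=
  ((finite_reducedSet J m n).image (exponentOf n)).toFinset

lemma reducedExponents_subset (J : Set (List ℕ)) (m n : ℕ) :
    reducedExponents J m n ⊆ piAntidiag univ m := by
  intro α hα
  rw [reducedExponents, Set.Finite.mem_toFinset] at hα
  obtain ⟨l, hl, rfl⟩ := hα
  exact exponentOf_mapsTo J m n hl

lemma card_reducedExponents_le (J : Set (List ℕ)) (m n : ℕ) :
    #(reducedExponents J m n) ≤ (reducedSet (homogeneousPart J (m + 1) n)).ncard := by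
  rw [reducedExponents, ← Set.ncard_eq_toFinset_card _ ((finite_reducedSet J m n).image _)]
  exact Set.ncard_image_le (finite_reducedSet J m n)

/-- A nonempty `j ∈ J` with entries at most `n` is `(j₀, k)` with `j₀ ∈ J(m + 1, n)*`, where `m`
is the length of `j₀`. -/
lemma countIndex_mem_cover {J : Set (List ℕ)} (hJ : J ⊆ allIndices) {n : ℕ} {j : List (Fin n)}
    (hj : j ∈ indicesIn J n) :
    countIndex j ∈ ({0} : Set (Fin n → ℕ)) ∪ ⋃ m, ⋃ p ∈ reducedExponents J m n ×ˢ univ,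
      {p.1 + Pi.single p.2 1} := by
  rcases List.eq_nil_or_concat' j with rfl | ⟨j₀, k, rfl⟩
  · left
    rfl
  · right
    simp only [Set.mem_iUnion]
    refine ⟨j₀.length, (countIndex j₀, k), ?_, ?_⟩
    · simp only [mem_product, mem_univ, and_true]
      rw [reducedExponents, Set.Finite.mem_toFinset]
      refine ⟨j₀.map fun i : Fin n => (i : ℕ) + 1, ?_, exponentOf_map j₀⟩
      have hj' : (j₀.map fun i : Fin n => (i : ℕ) + 1) ++ [(k : ℕ) + 1] ∈ J := by
        have : (j₀ ++ [k]).map (fun i : Fin n => (i : ℕ) + 1) ∈ J := mem_indicesIn.1 hj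
        simpa using this
      have hall := hJ hj'
      refine ⟨⟨(List.pairwise_append.1 hall.1).1,
        fun x hx => hall.2 x (List.mem_append_left _ hx)⟩, (k : ℕ) + 1, by omega, hj', by simp, ?_⟩
      intro x hx
      simp only [List.mem_append, List.mem_map, List.mem_singleton] at hx
      rcases hx with ⟨i, _, rfl⟩ | rfl
      · exact i.2
      · exact k.2
    · rw [countIndex_append, countIndex_singleton]
      rfl

lemma tsum_indicesIn_le {J : Set (List ℕ)} (hJ : J ⊆ allIndices) (n : ℕ)
    (G : (Fin n → ℕ) → ℝ≥0∞) :
    ∑' j : indicesIn J n, G (countIndex (j : List (Fin n)))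
      ≤ G 0 + ∑' m, ∑ α ∈ reducedExponents J m n, ∑ k, G (α + Pi.single k 1) := by
  set W : Set (Fin n → ℕ) := ({0} : Set (Fin n → ℕ)) ∪ ⋃ m,
    ⋃ p ∈ reducedExponents J m n ×ˢ univ, {p.1 + Pi.single p.2 1}
  have hinj : Function.Injective fun j : indicesIn J n =>
      (⟨countIndex (j : List (Fin n)), countIndex_mem_cover hJ j.2⟩ : W) := fun j j' h =>
    Subtype.ext (countIndex_injOn hJ j.2 j'.2 (congrArg Subtype.val h))
  calc _ ≤ ∑' α : W, G α := ENNReal.tsum_comp_le_tsum_of_injective hinj fun α : W => G α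
    _ ≤ _ := ENNReal.tsum_union_le G _ _
    _ ≤ _ := by
      gcongr
      · simp
      · refine (ENNReal.tsum_iUnion_le_tsum G _).trans (ENNReal.tsum_le_tsum fun m => ?_)
        refine (ENNReal.tsum_biUnion_le G _ _).trans ?_
        rw [sum_product]
        simp

/-- The number `N` of multi-indices of order `m` satisfies `N xᵐ ≤ (1 - x)⁻ⁿ`. -/
lemma card_piAntidiag_mul_pow_le (m n : ℕ) {x : ℝ} (hx0 : 0 ≤ x) (hx1 : x < 1) :
    (#(piAntidiag (univ : Finset (Fin n)) m) : ℝ) * x ^ m ≤ ((1 - x)⁻¹) ^ n := by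
  have h1 : ∀ α ∈ piAntidiag (univ : Finset (Fin n)) m, ∏ i, x ^ α i = x ^ m := fun α hα => by
    rw [prod_pow_eq_pow_sum, (mem_piAntidiag.1 hα).1]
  have hsub : piAntidiag (univ : Finset (Fin n)) m
      ⊆ Fintype.piFinset fun _ : Fin n => range (m + 1) := fun α hα => by
    rw [Fintype.mem_piFinset]
    exact fun i => mem_range.2 (Nat.lt_succ_of_le (le_of_mem_piAntidiag hα i))
  calc _ = ∑ α ∈ piAntidiag (univ : Finset (Fin n)) m, ∏ i, x ^ α i := by
        rw [sum_congr rfl h1, sum_const, nsmul_eq_mul]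
    _ ≤ ∑ α ∈ Fintype.piFinset fun _ : Fin n => range (m + 1), ∏ i, x ^ α i :=
        sum_le_sum_of_subset_of_nonneg hsub fun _ _ _ => prod_nonneg fun _ _ => by positivity
    _ = ∏ _i : Fin n, ∑ k ∈ range (m + 1), x ^ k :=
        (prod_univ_sum (fun _ : Fin n => range (m + 1)) fun _ k => x ^ k).symm
    _ = (∑ k ∈ range (m + 1), x ^ k) ^ n := by simp
    _ ≤ _ := by
        refine pow_le_pow_left₀ (sum_nonneg fun _ _ => by positivity) ?_ n
        have h2 := geom_sum_mul_neg x (m + 1)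
        rw [← one_div, le_div_iff₀ (by linarith), h2]
        have : 0 ≤ x ^ (m + 1) := by positivity
        linarith

end Indices

/-! ### The Bohr radius -/

section Radius

variable {n : ℕ} {r : ℝ≥0∞}

lemma bohrRadius_nonneg (R : Set (Fin n → ℂ)) (J : Set (List ℕ)) : 0 ≤ bohrRadius R J :=
  Real.sSup_nonneg fun _ h => h.1

lemma one_div_exp_pos : 0 < 1 / (3 * Real.exp 1 ^ 2) := by positivity

lemma six_mul_le : 6 * (1 / (3 * Real.exp 1 ^ 2)) ≤ 1 / 3 := by
  have h : 2.7 < Real.exp 1 := lt_trans (by norm_num) Real.exp_one_gt_d9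
  have h2 : (6 : ℝ) ≤ Real.exp 1 ^ 2 := by nlinarith
  rw [mul_one_div, div_le_div_iff₀ (by positivity) (by norm_num)]
  linarith

/-- The Bohr inequality: the homogeneous parts of `f` contribute a geometric series. -/
lemma bohr_inequality (hr : 1 ≤ r) {J : Set (List ℕ)} (hJ : J ⊆ allIndices) {ρ : ℝ} (hρ : 0 ≤ ρ)
    (hT : ∀ m, ρ ^ (m + 1) * (6 ^ (m + 1) * (#(reducedExponents J m n) : ℝ) ^ sigma r)
      ≤ (1 / 3) ^ (m + 1))
    {f : (Fin n → ℂ) → ℂ} (hf : IsBoundedHolomorphic (lpBall r n) f) :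
    (⨆ u ∈ ρ • lpBall r n,
      ∑' j : indicesIn J n, ‖monomialCoeff f j * monomialValue (j : List (Fin n)) u‖ₑ)
      ≤ supNorm (lpBall r n) f := by
  obtain ⟨hd, M', hM'⟩ := hf
  have hfin : supNorm (lpBall r n) f ≠ ∞ := by
    refine ne_top_of_le_ne_top ENNReal.ofReal_ne_top (iSup₂_le fun z hz => ?_ :
      supNorm (lpBall r n) f ≤ ENNReal.ofReal M')
    rw [← ofReal_norm]
    exact ENNReal.ofReal_le_ofReal (hM' z hz)
  set M := (supNorm (lpBall r n) f).toReal with hMdef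
  have hM : ∀ z ∈ lpBall r n, ‖f z‖ ≤ M := by
    intro z hz
    have h : ‖f z‖ₑ ≤ supNorm (lpBall r n) f := le_iSup₂ (f := fun z _ => ‖f z‖ₑ) z hz
    have := ENNReal.toReal_mono hfin h
    rwa [toReal_enorm] at this
  have h0 := zero_mem_lpBall hr n
  obtain ⟨a, ha, hP⟩ := exists_homogeneous_expansion (isOpen_lpBall hr n) h0
    (fun z hz t ht => smul_mem_lpBall hr hz ht) hd hM
  have ha0 : a 0 = f 0 := by
    have := ha []
    simp only [monomialCoeff, List.length_nil, iteratedFDeriv_zero_apply, List.count_nil,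
      Nat.factorial_zero, prod_const_one, Nat.cast_one, div_one] at this
    exact this.symm
  have hD : 0 ≤ M - ‖f 0‖ := sub_nonneg.2 (hM 0 h0)
  refine iSup₂_le fun u hu => ?_
  obtain ⟨v, hv, rfl⟩ := hu
  have hm : ∀ m, ∑ α ∈ reducedExponents J m n, ∑ k,
      ‖a (α + Pi.single k 1) * monom (α + Pi.single k 1) (ρ • v)‖ₑ
      ≤ ENNReal.ofReal ((1 / 3) ^ (m + 1) * (2 * (M - ‖f 0‖))) := by
    intro m
    have h1 := sum_coeff_le hr m a (hP (m + 1) (by omega)) hv (reducedExponents_subset J m n)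
    have h2 : ∀ α ∈ reducedExponents J m n, ∀ k : Fin n,
        ‖a (α + Pi.single k 1) * monom (α + Pi.single k 1) (ρ • v)‖
        = ρ ^ (m + 1) * ‖a (α + Pi.single k 1) * monom (α + Pi.single k 1) v‖ := by
      intro α hα k
      have h3 : ∑ i, (α + Pi.single k 1 : Fin n → ℕ) i = m + 1 := by
        simp [sum_add_distrib, (mem_piAntidiag.1 (reducedExponents_subset J m n hα)).1]
      have h4 : monom (α + Pi.single k 1) (ρ • v)
          = (ρ : ℂ) ^ (m + 1) * monom (α + Pi.single k 1) v := by
        rw [← h3, ← prod_pow_eq_pow_sum, monom, monom, ← prod_mul_distrib]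
        refine prod_congr rfl fun i _ => ?_
        rw [Pi.smul_apply, Complex.real_smul, mul_pow]
      rw [h4, norm_mul, norm_mul, norm_mul, norm_pow, Complex.norm_real, Real.norm_of_nonneg hρ]
      ring
    have h5 : ∑ α ∈ reducedExponents J m n, ∑ k,
        ‖a (α + Pi.single k 1) * monom (α + Pi.single k 1) (ρ • v)‖
        ≤ (1 / 3) ^ (m + 1) * (2 * (M - ‖f 0‖)) := by
      rw [sum_congr rfl fun α hα => sum_congr rfl fun k _ => h2 α hα k]
      simp_rw [← mul_sum]
      calc _ ≤ ρ ^ (m + 1) * (6 ^ (m + 1) * (#(reducedExponents J m n) : ℝ) ^ sigma r *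
            (2 * (M - ‖f 0‖))) := by gcongr
        _ = ρ ^ (m + 1) * (6 ^ (m + 1) * (#(reducedExponents J m n) : ℝ) ^ sigma r) *
            (2 * (M - ‖f 0‖)) := by ring
        _ ≤ _ := mul_le_mul_of_nonneg_right (hT m) (by positivity)
    refine le_trans (le_of_eq ?_) (ENNReal.ofReal_le_ofReal h5)
    rw [ENNReal.ofReal_sum_of_nonneg fun _ _ => sum_nonneg fun _ _ => norm_nonneg _]
    refine sum_congr rfl fun α _ => ?_
    rw [ENNReal.ofReal_sum_of_nonneg fun _ _ => norm_nonneg _]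
    exact sum_congr rfl fun k _ => (ofReal_norm _).symm
  have hsum : HasSum (fun m : ℕ => (1 / 3 : ℝ) ^ (m + 1) * (2 * (M - ‖f 0‖))) (M - ‖f 0‖) := by
    have h1 := ((hasSum_geometric_of_lt_one (r := (1 / 3 : ℝ)) (by norm_num)
      (by norm_num)).mul_left (1 / 3)).mul_right (2 * (M - ‖f 0‖))
    have h2 : 1 / 3 * (1 - 1 / 3)⁻¹ * (2 * (M - ‖f 0‖)) = M - ‖f 0‖ := by
      norm_num
      ring
    rw [h2] at h1
    simpa only [pow_succ'] using h1
  calc ∑' j : indicesIn J n, ‖monomialCoeff f j * monomialValue (j : List (Fin n)) (ρ • v)‖ₑ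
      = ∑' j : indicesIn J n, (fun α => ‖a α * monom α (ρ • v)‖ₑ)
          (countIndex (j : List (Fin n))) := by
        refine tsum_congr fun j => ?_
        rw [ha, monomialValue_eq]
    _ ≤ ‖a 0 * monom 0 (ρ • v)‖ₑ + ∑' m, ∑ α ∈ reducedExponents J m n, ∑ k,
          ‖a (α + Pi.single k 1) * monom (α + Pi.single k 1) (ρ • v)‖ₑ :=
        tsum_indicesIn_le hJ n fun α => ‖a α * monom α (ρ • v)‖ₑ
    _ ≤ ENNReal.ofReal ‖f 0‖ +
          ∑' m : ℕ, ENNReal.ofReal ((1 / 3) ^ (m + 1) * (2 * (M - ‖f 0‖))) := by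
        gcongr with m
        · rw [ha0, ofReal_norm]; simp [monom]
        · exact hm m
    _ = ENNReal.ofReal ‖f 0‖ + ENNReal.ofReal (M - ‖f 0‖) := by
        rw [← ENNReal.ofReal_tsum_of_nonneg (fun m => by positivity) hsum.summable, hsum.tsum_eq]
    _ = ENNReal.ofReal M := by
        rw [← ENNReal.ofReal_add (norm_nonneg _) hD]; congr 1; ring
    _ = supNorm (lpBall r n) f := ENNReal.ofReal_toReal hfin

/-- The number of multi-indices of order `m` is at most `2 ^ (n + m)`. -/
lemma bddAbove_ncard_rpow (hr : 1 ≤ r) (J : Set (List ℕ)) (n : ℕ) :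
    BddAbove (Set.range fun m : ℕ+ =>
      ((reducedSet (homogeneousPart J m n)).ncard : ℝ) ^ (sigma r / (m : ℝ))) := by
  refine ⟨2 ^ (n + 1), ?_⟩
  rintro _ ⟨m, rfl⟩
  obtain ⟨k, rfl⟩ : ∃ k : ℕ, m = k.succPNat := ⟨m.natPred, (PNat.succPNat_natPred m).symm⟩
  simp only [Nat.succPNat_coe, Nat.succ_eq_add_one]
  have h1 := card_piAntidiag_mul_pow_le k n (x := 1 / 2) (by norm_num) (by norm_num)
  have h2 : ((reducedSet (homogeneousPart J (k + 1) n)).ncard : ℝ)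
      ≤ (2 ^ (n + 1)) ^ (k + 1) := by
    have h3 : ((reducedSet (homogeneousPart J (k + 1) n)).ncard : ℝ)
        ≤ #(piAntidiag (univ : Finset (Fin n)) k) := by exact_mod_cast ncard_reducedSet_le J k n
    have h4 : (#(piAntidiag (univ : Finset (Fin n)) k) : ℝ) ≤ 2 ^ n * 2 ^ k := by
      norm_num at h1
      rwa [one_div, inv_pow, ← div_eq_mul_inv, div_le_iff₀ (by positivity)] at h1
    refine h3.trans (h4.trans ?_)
    rw [← pow_add, ← pow_mul]
    exact pow_le_pow_right₀ (by norm_num) (by nlinarith)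
  have hk : (0 : ℝ) < ((k + 1 : ℕ) : ℝ) := by positivity
  have h1le : (1 : ℝ) ≤ (2 ^ (n + 1)) ^ (k + 1) := one_le_pow₀ (one_le_pow₀ (by norm_num))
  calc _ ≤ ((2 ^ (n + 1)) ^ (k + 1) : ℝ) ^ (sigma r / ((k + 1 : ℕ) : ℝ)) :=
        Real.rpow_le_rpow (Nat.cast_nonneg _) h2 (div_nonneg (sigma_nonneg hr) hk.le)
    _ ≤ ((2 ^ (n + 1)) ^ (k + 1) : ℝ) ^ (1 / ((k + 1 : ℕ) : ℝ)) := by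
        refine Real.rpow_le_rpow_of_exponent_le h1le ?_
        gcongr
        exact sigma_le_one r
    _ = 2 ^ (n + 1) := by
        rw [one_div]
        exact Real.pow_rpow_inv_natCast (by positivity) (Nat.succ_ne_zero k)

/-- The lower bound of the Bohr radius in terms of the size of the reduced index sets. -/
lemma div_iSup_le_bohrRadius (hr : 1 ≤ r) {J : Set (List ℕ)} (hJ : J ⊆ allIndices) (n : ℕ) :
    1 / (3 * Real.exp 1 ^ 2) / (⨆ m : ℕ+,
      ((reducedSet (homogeneousPart J m n)).ncard : ℝ) ^ (sigma r / (m : ℝ)))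
      ≤ bohrRadius (lpBall r n) J := by
  have hbdd := bddAbove_ncard_rpow hr J n
  set F : ℕ+ → ℝ := fun m =>
    ((reducedSet (homogeneousPart J m n)).ncard : ℝ) ^ (sigma r / (m : ℝ)) with hF
  set S := ⨆ m, F m with hS
  have hF0 : ∀ m, 0 ≤ F m := fun m => Real.rpow_nonneg (Nat.cast_nonneg _) _
  have hS0 : 0 ≤ S := Real.iSup_nonneg hF0
  rcases hS0.eq_or_lt with h | hSpos
  · -- division by `0` gives `0`
    rw [← h, div_zero]
    exact bohrRadius_nonneg _ _
  -- each term of the supremum is either `0` or at least `1`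
  have hS1 : 1 ≤ S := by
    obtain ⟨m, hm⟩ : ∃ m, 0 < F m := by
      by_contra! hcon
      exact absurd (Real.iSup_nonpos hcon) (not_le.2 hSpos)
    refine le_trans ?_ (le_ciSup hbdd m)
    rcases Nat.eq_zero_or_pos (reducedSet (homogeneousPart J m n)).ncard with h0 | h0
    · simp only [hF, h0, Nat.cast_zero] at hm ⊢
      by_contra hlt
      have hne : sigma r / (m : ℝ) ≠ 0 := by
        intro h; rw [h, Real.rpow_zero] at hlt; exact hlt le_rfl
      rw [Real.zero_rpow hne] at hm
      exact lt_irrefl _ hm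
    · exact Real.one_le_rpow (by exact_mod_cast h0)
        (div_nonneg (sigma_nonneg hr) (Nat.cast_nonneg _))
  refine le_csSup ⟨1, fun _ h => h.2.1⟩ ⟨by positivity, ?_, fun f hf => ?_⟩
  · rw [div_le_one hSpos]
    exact le_trans (by linarith [six_mul_le, one_div_exp_pos]) hS1
  · refine bohr_inequality hr hJ (by positivity) (fun m => ?_) hf
    have h1 : (#(reducedExponents J m n) : ℝ) ^ sigma r ≤ S ^ (m + 1) := by
      have h2 : F m.succPNat ≤ S := le_ciSup hbdd _
      have h3 : F m.succPNat ^ (m + 1)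
          = ((reducedSet (homogeneousPart J (m + 1) n)).ncard : ℝ) ^ sigma r := by
        simp only [hF, Nat.succPNat_coe, Nat.succ_eq_add_one]
        rw [← Real.rpow_natCast, ← Real.rpow_mul (Nat.cast_nonneg _)]
        congr 1
        field_simp
      calc _ ≤ ((reducedSet (homogeneousPart J (m + 1) n)).ncard : ℝ) ^ sigma r :=
            Real.rpow_le_rpow (Nat.cast_nonneg _)
              (by exact_mod_cast card_reducedExponents_le J m n) (sigma_nonneg hr)
        _ = F m.succPNat ^ (m + 1) := h3.symm
        _ ≤ _ := pow_le_pow_left₀ (hF0 _) h2 _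
    calc _ ≤ (1 / (3 * Real.exp 1 ^ 2) / S) ^ (m + 1) * (6 ^ (m + 1) * S ^ (m + 1)) := by gcongr
      _ = (6 * (1 / (3 * Real.exp 1 ^ 2))) ^ (m + 1) := by
          rw [← mul_pow, ← mul_pow]
          congr 1
          field_simp
      _ ≤ _ := pow_le_pow_left₀ (by positivity) six_mul_le _

/-- The bound `N xᵐ ≤ (1 - x)⁻ⁿ` at `x = log n / (4 n)`, where
`(1 - x)⁻ⁿ ≤ exp (2 x n) = √n ≤ 4 n / log n`. -/
lemma ncard_reducedSet_le_pow {n : ℕ} (hn : 2 ≤ n) (J : Set (List ℕ)) (m : ℕ) :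
    ((reducedSet (homogeneousPart J (m + 1) n)).ncard : ℝ)
      ≤ (4 * n / Real.log n) ^ (m + 1) := by
  have hn' : (2 : ℝ) ≤ n := by exact_mod_cast hn
  set L := Real.log n with hL
  have hLpos : 0 < L := Real.log_pos (by linarith)
  have hLn : L ≤ n := (Real.log_le_sub_one_of_pos (by linarith)).trans (by linarith)
  set x := L / (4 * n) with hx
  have hx0 : 0 < x := by positivity
  have hx1 : x ≤ 1 / 4 := by rw [hx, div_le_iff₀ (by positivity)]; linarith
  have h1 := card_piAntidiag_mul_pow_le m n hx0.le (by linarith)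
  have h2 : (1 - x)⁻¹ ≤ Real.exp (2 * x) := by
    rw [← one_div, div_le_iff₀ (by linarith)]
    have h3 := Real.add_one_le_exp (2 * x)
    nlinarith
  have h4 : ((1 - x)⁻¹) ^ n ≤ Real.exp (L / 2) := by
    calc _ ≤ Real.exp (2 * x) ^ n :=
          pow_le_pow_left₀ (inv_nonneg.2 (by linarith)) h2 n
      _ = Real.exp (L / 2) := by
          rw [← Real.exp_nat_mul]
          congr 1
          rw [hx]
          field_simp
          norm_num
  have h5 : Real.exp (L / 2) ≤ 4 * n / L := by
    have h6 := Real.add_one_le_exp (L / 2)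
    have h7 : Real.exp (L / 2) * Real.exp (L / 2) = n := by
      rw [← Real.exp_add, add_halves, hL, Real.exp_log (by linarith)]
    rw [le_div_iff₀ hLpos]
    nlinarith [Real.exp_pos (L / 2)]
  have h8 : (#(piAntidiag (univ : Finset (Fin n)) m) : ℝ) ≤ (4 * n / L) ^ (m + 1) := by
    have h9 : (4 * n / L) = x⁻¹ := by rw [hx, inv_div]
    have h10 := h1.trans (h4.trans h5)
    rw [h9] at h10 ⊢
    rw [pow_succ, inv_pow, ← div_eq_inv_mul]
    rwa [le_div_iff₀ (by positivity)]
  exact le_trans (by exact_mod_cast ncard_reducedSet_le J m n) h8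

lemma one_le_ncard_reducedSet_allIndices {n : ℕ} (hn : 1 ≤ n) :
    1 ≤ (reducedSet (homogeneousPart allIndices 1 n)).ncard := by
  refine (Set.ncard_pos (finite_reducedSet allIndices 0 n)).2 ?_
  exact ⟨[], by simp [allIndices], 1, le_rfl, by simp [allIndices], by simp, by simpa using hn⟩

end Radius

end

end BohrRadius

theorem mainTheorem9 (r : ℝ≥0∞) (hr : 1 ≤ r) :
    (∃ C : ℝ, 1 / (3 * Real.exp 1 ^ 2) ≤ C ∧
      ∀ J : Set (List ℕ), J ⊆ BohrRadius.allIndices → ∀ n : ℕ, 1 ≤ n →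
        BddAbove (Set.range fun m : ℕ+ =>
          ((BohrRadius.reducedSet (BohrRadius.homogeneousPart J m n)).ncard : ℝ) ^
            (BohrRadius.sigma r / (m : ℝ))) ∧
        C / (⨆ m : ℕ+,
          ((BohrRadius.reducedSet (BohrRadius.homogeneousPart J m n)).ncard : ℝ) ^
            (BohrRadius.sigma r / (m : ℝ))) ≤
          BohrRadius.bohrRadius (BohrRadius.lpBall r n) J) ∧
    (∃ c : ℝ, 0 < c ∧ ∀ n : ℕ, 1 ≤ n →
      c * (Real.log n / n) ^ BohrRadius.sigma r ≤
        BohrRadius.bohrRadius (BohrRadius.lpBall r n) BohrRadius.allIndices) := by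
  refine ⟨⟨_, le_rfl, fun J hJ n _ => ⟨BohrRadius.bddAbove_ncard_rpow hr J n,
    BohrRadius.div_iSup_le_bohrRadius hr hJ n⟩⟩,
    1 / (3 * Real.exp 1 ^ 2) / 4, by positivity, fun n hn => ?_⟩
  have hσ := BohrRadius.sigma_nonneg hr
  have hσ1 := BohrRadius.sigma_le_one r
  have hmain := BohrRadius.div_iSup_le_bohrRadius hr (subset_refl BohrRadius.allIndices) n
  have hbdd := BohrRadius.bddAbove_ncard_rpow hr BohrRadius.allIndices n
  set S := ⨆ m : ℕ+,
    ((BohrRadius.reducedSet (BohrRadius.homogeneousPart BohrRadius.allIndices m n)).ncard : ℝ) ^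
      (BohrRadius.sigma r / (m : ℝ)) with hS
  have hS1 : 1 ≤ S := by
    refine le_trans ?_ (le_ciSup hbdd 1)
    exact Real.one_le_rpow
      (by exact_mod_cast BohrRadius.one_le_ncard_reducedSet_allIndices hn) (by simpa using hσ)
  refine le_trans ?_ hmain
  set C := 1 / (3 * Real.exp 1 ^ 2)
  have hC : 0 < C := BohrRadius.one_div_exp_pos
  rw [le_div_iff₀ (by linarith)]
  rcases hσ.eq_or_lt with h0 | hpos
  · -- for `σ = 0` all powers are equal to `1`, also `0 ^ 0`
    have hS' : S = 1 := by
      rw [hS]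
      simp [← h0]
    rw [hS', ← h0, Real.rpow_zero]
    linarith
  rcases hn.eq_or_lt with rfl | hn2
  · rw [Nat.cast_one, Real.log_one, zero_div, Real.zero_rpow hpos.ne']
    simpa using hC.le
  have hn' : (2 : ℝ) ≤ n := by exact_mod_cast hn2
  have hL : 0 < Real.log n := Real.log_pos (by linarith)
  have hSle : S ≤ (4 * n / Real.log n) ^ BohrRadius.sigma r := by
    refine ciSup_le fun m => ?_
    obtain ⟨k, rfl⟩ : ∃ k : ℕ, m = k.succPNat := ⟨m.natPred, (PNat.succPNat_natPred m).symm⟩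
    simp only [Nat.succPNat_coe, Nat.succ_eq_add_one]
    refine (Real.rpow_le_rpow (Nat.cast_nonneg _)
      (BohrRadius.ncard_reducedSet_le_pow hn2 BohrRadius.allIndices k)
      (by positivity)).trans (le_of_eq ?_)
    rw [← Real.rpow_natCast, ← Real.rpow_mul (by positivity)]
    congr 1
    field_simp
  calc C / 4 * (Real.log n / n) ^ BohrRadius.sigma r * S
      ≤ C / 4 * (Real.log n / n) ^ BohrRadius.sigma r *
        (4 * n / Real.log n) ^ BohrRadius.sigma r := by gcongr
    _ = C / 4 * 4 ^ BohrRadius.sigma r := by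
        rw [mul_assoc, ← Real.mul_rpow (by positivity) (by positivity)]
        congr 2
        field_simp
    _ ≤ C / 4 * 4 := by
        gcongr
        exact Real.rpow_le_self_of_one_le (by norm_num) hσ1
    _ = C := by ring
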